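/- An instance of the all-or-nothing multicommodity flow problem consists of a directed graph $G=(V,E)$ with edge capacities $c(e)\in\mathbb Z_{\ge 0}$ and $k$ pairs $(s_i,t_i)\in V\times V$, each with a demand $d_i\in\mathbb Z_{\ge 0}$ and a rational weight $w_i\ge 0$. Let $\mathcal F_i$ be the set of all $f:E\to\mathbb R_{\ge 0}$ with $f(e)\le c(e)$ for all $e\in E$ that route $d_i$ units from $s_i$ to $t_i$, that is, for each vertex $v$ the outflow minus the inflow of $f$ at $v$ is $d_i[v=s_i]-d_i[v=t_i]$. The dual of the packing LP relaxation, in the variables $\ell\in\mathbb R^E$ and $z\in\mathbb R^k$, is $$\min \sum_{e\in E}c(e)\ell_e+\sum_{i=1}^k z_i\quad\text{subject to}\quad z_i+\sum_{e\in E}f(e)\ell_e\ge w_i\ \ (1\le i\le k,\ f\in\mathcal F_i),\qquad \ell\ge 0,\quad z\ge 0 .$$ **Lemma.** There is a polynomial-time separation oracle for this dual LP: an algorithm that, given an instance (its vertices, its edges and its pairs listed explicitly) and a rational point $(\ell,z)$, runs in time polynomial in the bit size of this input and either confirms that $(\ell,z)$ is feasible, or returns a constraint of the dual LP that $(\ell,z)$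 violates. If $\ell\ge 0$ and $z\ge 0$, the oracle also returns for each $i$ an integral flow $f_i\in\mathcal F_i$ of minimum cost $\sum_{e} f_i(e)\ell_e$ among all flows in $\mathcal F_i$, or reports that $\mathcal F_i=\emptyset$; and if $(\ell,z)$ is then infeasible, the violated constraint that it returns is the one of a pair $i$ and its minimum-cost flow $f_i$. Moreover, let $q_i=\inf_{f\in\mathcal F_i}\sum_{e}f(e)\ell_e\in(-\infty,+\infty]$ (with $q_i=+\infty$ if $\mathcal F_i=\emptyset$). For every instance and all real $\ell\ge 0$, $z\ge 0$, the point $(\ell,z)$ is feasible for the dual LP if and only if $z_i+q_i\ge w_i$ for all $1\le i\le k$. -/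

import Mathlib

/-! ### A machine model with a step count

`WHILE` programs over binary trees whose leaves are integers, under the logarithmic cost criterion:
every value that is touched is charged its bit size. Running times in this model and on
multitape Turing machines bound each other polynomially. -/

namespace While

/-- Data: binary trees with integer leaves. -/
inductive Val : Type
  | int (a : ℤ) : Val
  | pair (x y : Val) : Val

namespace Val

/-- The bit size of a value (an integer contributes its binary length). -/
def size : Val → ℕ
  | int a => 1 + a.natAbs.size
  | pair x y => 1 + x.size + y.size

def fst : Val → Val
  | int _ => int 0
  | pair x _ => x

def snd : Val → Val
  | int _ => int 0
  | pair _ y => y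

def toInt : Val → ℤ
  | int a => a
  | pair _ _ => 0

def isPair : Val → Bool
  | int _ => false
  | pair _ _ => true

def ofBool (b : Bool) : Val := int (if b then 1 else 0)

/-- Only the leaf `0` counts as false. -/
def IsTrue (v : Val) : Prop := v ≠ int 0

/-- A list is a right-nested sequence of pairs that ends in the leaf `0`. -/
def ofList : List Val → Val
  | [] => int 0
  | v :: l => pair v (ofList l)

end Val

/-- A state assigns a value to every variable; a program mentions only finitely many of them. -/
abbrev State : Type := ℕ → Val

inductive Expr : Type
  | var (x : ℕ) : Expr
  | const (a : ℤ) : Expr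
  | pair (e₁ e₂ : Expr) : Expr
  | fst (e : Expr) : Expr
  | snd (e : Expr) : Expr
  | isPair (e : Expr) : Expr
  | plus (e₁ e₂ : Expr) : Expr
  | minus (e₁ e₂ : Expr) : Expr
  | times (e₁ e₂ : Expr) : Expr
  | quot (e₁ e₂ : Expr) : Expr
  | le (e₁ e₂ : Expr) : Expr

namespace Expr

def eval (σ : State) : Expr → Val
  | var x => σ x
  | const a => .int a
  | pair e₁ e₂ => .pair (e₁.eval σ) (e₂.eval σ)
  | fst e => (e.eval σ).fst
  | snd e => (e.eval σ).snd
  | isPair e => .ofBool (e.eval σ).isPair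
  | plus e₁ e₂ => .int ((e₁.eval σ).toInt + (e₂.eval σ).toInt)
  | minus e₁ e₂ => .int ((e₁.eval σ).toInt - (e₂.eval σ).toInt)
  | times e₁ e₂ => .int ((e₁.eval σ).toInt * (e₂.eval σ).toInt)
  | quot e₁ e₂ => .int ((e₁.eval σ).toInt / (e₂.eval σ).toInt)
  | le e₁ e₂ => .ofBool (decide ((e₁.eval σ).toInt ≤ (e₂.eval σ).toInt))

/-- The cost of evaluating an expression: the sum, over all its subexpressions, of the bit sizes of
their values. -/
def cost (σ : State) : Expr → ℕ
  | var x => (σ x).size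
  | const a => (Val.int a).size
  | pair e₁ e₂ => e₁.cost σ + e₂.cost σ + ((pair e₁ e₂).eval σ).size
  | fst e => e.cost σ + ((fst e).eval σ).size
  | snd e => e.cost σ + ((snd e).eval σ).size
  | isPair e => e.cost σ + ((isPair e).eval σ).size
  | plus e₁ e₂ => e₁.cost σ + e₂.cost σ + ((plus e₁ e₂).eval σ).size
  | minus e₁ e₂ => e₁.cost σ + e₂.cost σ + ((minus e₁ e₂).eval σ).size
  | times e₁ e₂ => e₁.cost σ + e₂.cost σ + ((times e₁ e₂).eval σ).size
  | quot e₁ e₂ => e₁.cost σ + e₂.cost σ + ((quot e₁ e₂).eval σ).size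
  | le e₁ e₂ => e₁.cost σ + e₂.cost σ + ((le e₁ e₂).eval σ).size

end Expr

inductive Cmd : Type
  | skip : Cmd
  | assign (x : ℕ) (e : Expr) : Cmd
  | seq (c₁ c₂ : Cmd) : Cmd
  | ite (e : Expr) (c₁ c₂ : Cmd) : Cmd
  | loop (e : Expr) (c : Cmd) : Cmd

/-- `Exec c σ τ t`: started in state `σ`, the command `c` halts in state `τ` after time `t`. -/
inductive Exec : Cmd → State → State → ℕ → Prop
  | skip (σ : State) : Exec .skip σ σ 1
  | assign (x : ℕ) (e : Expr) (σ : State) :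
      Exec (.assign x e) σ (Function.update σ x (e.eval σ)) (1 + e.cost σ)
  | seq {c₁ c₂ : Cmd} {σ τ ρ : State} {t₁ t₂ : ℕ} (h₁ : Exec c₁ σ τ t₁) (h₂ : Exec c₂ τ ρ t₂) :
      Exec (.seq c₁ c₂) σ ρ (t₁ + t₂)
  | ite_true {e : Expr} {c₁ c₂ : Cmd} {σ τ : State} {t : ℕ} (he : (e.eval σ).IsTrue)
      (h : Exec c₁ σ τ t) : Exec (.ite e c₁ c₂) σ τ (1 + e.cost σ + t)
  | ite_false {e : Expr} {c₁ c₂ : Cmd} {σ τ : State} {t : ℕ} (he : ¬ (e.eval σ).IsTrue)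
      (h : Exec c₂ σ τ t) : Exec (.ite e c₁ c₂) σ τ (1 + e.cost σ + t)
  | loop_true {e : Expr} {c : Cmd} {σ τ ρ : State} {t₁ t₂ : ℕ} (he : (e.eval σ).IsTrue)
      (h₁ : Exec c σ τ t₁) (h₂ : Exec (.loop e c) τ ρ t₂) :
      Exec (.loop e c) σ ρ (1 + e.cost σ + t₁ + t₂)
  | loop_false {e : Expr} {c : Cmd} {σ : State} (he : ¬ (e.eval σ).IsTrue) :
      Exec (.loop e c) σ σ (1 + e.cost σ)

/-- The input is in variable `0`, and all other variables hold the leaf `0`. -/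
def initState (v : Val) : State := fun x => if x = 0 then v else .int 0

/-- On input `v`, the program `c` halts after time `t` with output `u` (in variable `0`). -/
def Outputs (c : Cmd) (v u : Val) (t : ℕ) : Prop :=
  ∃ τ : State, Exec c (initState v) τ t ∧ τ 0 = u

/-- The search problem "given `a`, find some `b` with `spec a b`" is solved by a program whose
running time is bounded by a polynomial in the bit size of the encoded input. -/
def SolvableInPolyTime {α : Type} {β : α → Type} (encIn : α → Val) (encOut : ∀ a, β a → Val)
    (spec : ∀ a, β a → Prop) : Prop :=
  ∃ (c : Cmd) (p : Polynomial ℕ), ∀ a : α, ∃ (b : β a) (t : ℕ),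
    Outputs c (encIn a) (encOut a b) t ∧ t ≤ p.eval (encIn a).size ∧ spec a b

end While

/-! ### The packing formulation of all-or-nothing multicommodity flow -/

namespace ANF

/-- A directed graph with `n` vertices and `m` edges, edge capacities, and `k` demand pairs with
demands and weights. -/
structure Instance where
  n : ℕ
  m : ℕ
  k : ℕ
  tail : Fin m → Fin n
  head : Fin m → Fin n
  cap : Fin m → ℕ
  source : Fin k → Fin n
  target : Fin k → Fin n
  demand : Fin k → ℕ
  weight : Fin k → ℚ
  weight_nonneg : ∀ i, 0 ≤ weight i

namespace Instance

variable (I : Instance)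

def outflow (f : Fin I.m → ℝ) (v : Fin I.n) : ℝ := ∑ e with I.tail e = v, f e

def inflow (f : Fin I.m → ℝ) (v : Fin I.n) : ℝ := ∑ e with I.head e = v, f e

/-- The set `𝓕 i` of the valid flows for pair `i`: they respect the capacities and route
`demand i` units from `source i` to `target i`. -/
def validFlows (i : Fin I.k) : Set (Fin I.m → ℝ) :=
  {f | (∀ e, 0 ≤ f e ∧ f e ≤ I.cap e) ∧
    ∀ v, I.outflow f v - I.inflow f v =
      (if v = I.source i then (I.demand i : ℝ) else 0) -
        (if v = I.target i then (I.demand i : ℝ) else 0)}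

/-- The cost of a flow with respect to edge costs `ℓ`. -/
def cost (ℓ f : Fin I.m → ℝ) : ℝ := ∑ e, f e * ℓ e

/-- The feasible region of the dual of the packing LP. -/
def DualFeasible (ℓ : Fin I.m → ℝ) (z : Fin I.k → ℝ) : Prop :=
  (∀ i, ∀ f ∈ I.validFlows i, (I.weight i : ℝ) ≤ z i + ∑ e, f e * ℓ e) ∧
    (∀ e, 0 ≤ ℓ e) ∧ (∀ i, 0 ≤ z i)

def IsMinCostFlow (ℓ : Fin I.m → ℝ) (i : Fin I.k) (f : Fin I.m → ℝ) : Prop :=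
  f ∈ I.validFlows i ∧ ∀ g ∈ I.validFlows i, I.cost ℓ f ≤ I.cost ℓ g

/-- The minimum cost `q i` of a valid flow for pair `i`; it is `⊤` if there is none. -/
noncomputable def minCost (ℓ : Fin I.m → ℝ) (i : Fin I.k) : EReal :=
  ⨅ f ∈ I.validFlows i, (I.cost ℓ f : EReal)

end Instance

/-- The input of the oracle: an instance and a rational point `(ℓ, z)` of the dual space. -/
structure Query where
  inst : Instance
  len : Fin inst.m → ℚ
  z : Fin inst.k → ℚ

namespace Query

def lenReal (Q : Query) : Fin Q.inst.m → ℝ := fun e => (Q.len e : ℝ)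

def zReal (Q : Query) : Fin Q.inst.k → ℝ := fun i => (Q.z i : ℝ)

end Query

/-- The answers of the oracle.
* `negLen e`: the constraint `0 ≤ ℓ e` is violated;
* `negZ i`: the constraint `0 ≤ z i` is violated;
* `checked flows none`: the point is feasible;
* `checked flows (some i)`: the constraint of pair `i` and of the flow `flows i` is violated.

Here `flows` lists an integral minimum-cost flow for each pair (`none` if there is no valid
flow). -/
inductive Answer (Q : Query) : Type
  | negLen (e : Fin Q.inst.m) : Answer Q
  | negZ (i : Fin Q.inst.k) : Answer Q
  | checked (flows : Fin Q.inst.k → Option (Fin Q.inst.m → ℕ)) (verdict : Option (Fin Q.inst.k)) :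
      Answer Q

/-- Correctness of the flow listed for pair `i`. -/
def Query.CorrectFlow (Q : Query) (i : Fin Q.inst.k) : Option (Fin Q.inst.m → ℕ) → Prop
  | none => Q.inst.validFlows i = ∅
  | some f => Q.inst.IsMinCostFlow Q.lenReal i (fun e => (f e : ℝ))

/-- Correctness of an answer of a separation oracle for the dual of the packing LP. -/
def Answer.Correct (Q : Query) : Answer Q → Prop
  | .negLen e => Q.lenReal e < 0
  | .negZ i => Q.zReal i < 0
  | .checked flows verdict =>
      (∀ e, 0 ≤ Q.lenReal e) ∧ (∀ i, 0 ≤ Q.zReal i) ∧ (∀ i, Q.CorrectFlow i (flows i)) ∧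
      match verdict with
      | none => Q.inst.DualFeasible Q.lenReal Q.zReal
      | some i => ∃ f : Fin Q.inst.m → ℕ, flows i = some f ∧
          Q.zReal i + ∑ e, (f e : ℝ) * Q.lenReal e < (Q.inst.weight i : ℝ)

/-! ### Encodings: all numbers are written in binary, graphs as lists of vertices and of edges -/

open While

def encNat (a : ℕ) : Val := .int a

def encRat (q : ℚ) : Val := .pair (.int q.num) (.int q.den)

def encFun {r : ℕ} (g : Fin r → Val) : Val := .ofList (List.ofFn g)

def encOption {α : Type} (enc : α → Val) : Option α → Val
  | none => .int 0
  | some a => .pair (.int 1) (enc a)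

def encInstance (I : Instance) : Val :=
  .pair (encFun fun v : Fin I.n => encNat v)
    (.pair
      (encFun fun e : Fin I.m => .pair (encNat (I.tail e)) (.pair (encNat (I.head e))
        (encNat (I.cap e))))
      (encFun fun i : Fin I.k => .pair (encNat (I.source i)) (.pair (encNat (I.target i))
        (.pair (encNat (I.demand i)) (encRat (I.weight i))))))

def encQuery (Q : Query) : Val :=
  .pair (encInstance Q.inst)
    (.pair (encFun fun e => encRat (Q.len e)) (encFun fun i => encRat (Q.z i)))

def encAnswer (Q : Query) : Answer Q → Val
  | .negLen e => .pair (.int 0) (encNat e)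
  | .negZ i => .pair (.int 1) (encNat i)
  | .checked flows verdict =>
      .pair (.int 2) (.pair
        (encFun fun i => encOption (fun f => encFun fun e => encNat (f e)) (flows i))
        (encOption (fun i : Fin Q.inst.k => encNat i) verdict))

end ANF

/-! For fixed nonnegative `ℓ`, the constraints of a pair differ only in the cost of the flow, so the
tightest one belongs to a cheapest flow. This gives the criterion with `minCost`
(`Instance.dualFeasible_iff_minCost`); the empty infimum is `⊤` and imposes nothing. Separation
therefore amounts to sign checks and one minimum-cost flow per pair.

Such a flow is obtained from a minimum-cost circulation. The lengths are scaled to integers, and an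
edge from target to source is added whose capacity is the demand and whose negative cost outweighs
the cost of every flow. An optimal circulation saturates this edge exactly when a valid flow exists,
and the other edges then carry an optimal flow (`edgeFlow_minCost`, `validFlows_eq_empty`). It is
integral because the algorithm only handles integers.

Circulations are computed by capacity scaling. Potentials with complementary slackness certify
optimality even against real circulations (`Opt.cost_le`). Passing to the next binary digit of the
capacities doubles capacities and flow and then raises some capacities by one; each such unit is
repaired by one primal-dual search for an augmenting path (`bump_valid`). So each digit costs at
most one search per edge.

For the running time, `PolyTime` is a calculus of uniform polynomial-time transformations closed
under composition, arithmetic, branching and loops. Its loop rule asks for polynomial bounds on the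
number of iterations and on the size of every intermediate state. The latter come from the fact that
a search step adds at most two bits to the numbers involved (`search_bdd`, `scaling_bdd`). -/

namespace While

/-! ### Polynomial bounds -/

/-- `y` is bounded by a polynomial in `x`, uniformly in the index. -/
def PolyBdd {Γ : Type} (x y : Γ → ℕ) : Prop := ∃ b, ∀ γ, y γ ≤ (x γ + 2) ^ b

namespace PolyBdd

variable {Γ Δ : Type} {x y z : Γ → ℕ}

theorem mono (h : PolyBdd x y) (hz : ∀ γ, z γ ≤ y γ) : PolyBdd x z :=
  h.imp fun _ hb γ => (hz γ).trans (hb γ)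

theorem refl (x : Γ → ℕ) : PolyBdd x x := ⟨1, fun γ => by simp⟩

/-- The base `x + 2` is at least 2, so `c < 2 ^ c` suffices. For the same reason a single exponent
absorbs all coefficients. -/
theorem const (x : Γ → ℕ) (c : ℕ) : PolyBdd x fun _ => c :=
  ⟨c, fun γ => (Nat.lt_two_pow_self.le).trans (Nat.pow_le_pow_left (by omega) _)⟩

theorem add (hy : PolyBdd x y) (hz : PolyBdd x z) : PolyBdd x fun γ => y γ + z γ := by
  obtain ⟨a, ha⟩ := hy
  obtain ⟨b, hb⟩ := hz
  refine ⟨max a b + 1, fun γ => ?_⟩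
  have h1 : (x γ + 2) ^ a ≤ (x γ + 2) ^ max a b :=
    Nat.pow_le_pow_right (by omega) (le_max_left _ _)
  have h2 : (x γ + 2) ^ b ≤ (x γ + 2) ^ max a b :=
    Nat.pow_le_pow_right (by omega) (le_max_right _ _)
  have h3 := ha γ
  have h4 := hb γ
  rw [pow_succ]
  nlinarith

theorem mul (hy : PolyBdd x y) (hz : PolyBdd x z) : PolyBdd x fun γ => y γ * z γ := by
  obtain ⟨a, ha⟩ := hy
  obtain ⟨b, hb⟩ := hz
  exact ⟨a + b, fun γ => by rw [pow_add]; exact Nat.mul_le_mul (ha γ) (hb γ)⟩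

theorem trans (hy : PolyBdd x y) (hz : PolyBdd y z) : PolyBdd x z := by
  obtain ⟨a, ha⟩ := hy
  obtain ⟨b, hb⟩ := hz
  -- With `A = (x + 2) ^ a ≥ 1` one has `A + 2 ≤ 4 * A ≤ (x + 2) ^ (a + 2)`.
  refine ⟨(a + 2) * b, fun γ => (hb γ).trans ?_⟩
  rw [pow_mul]
  refine Nat.pow_le_pow_left ?_ b
  have h := ha γ
  have h1 : 1 ≤ (x γ + 2) ^ a := Nat.one_le_pow _ _ (by omega)
  have h2 : 4 ≤ (x γ + 2) ^ 2 := by nlinarith [Nat.zero_le (x γ)]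
  rw [pow_add]
  nlinarith

theorem comap (h : PolyBdd x y) (ρ : Δ → Γ) : PolyBdd (fun δ => x (ρ δ)) fun δ => y (ρ δ) :=
  h.imp fun _ hb δ => hb (ρ δ)

theorem of_le (h : ∀ γ, y γ ≤ x γ) : PolyBdd x y := (refl x).mono h

end PolyBdd

/-! ### Bit sizes of values, lists and arithmetic results. -/

namespace Val

@[simp] theorem size_int (a : ℤ) : (int a).size = 1 + a.natAbs.size := rfl
@[simp] theorem size_pair (u v : Val) : (pair u v).size = 1 + u.size + v.size := rfl
@[simp] theorem fst_pair (u v : Val) : (pair u v).fst = u := rfl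
@[simp] theorem snd_pair (u v : Val) : (pair u v).snd = v := rfl
@[simp] theorem toInt_int (a : ℤ) : (int a).toInt = a := rfl
@[simp] theorem ofList_nil : ofList [] = int 0 := rfl
@[simp] theorem ofList_cons (v : Val) (l : List Val) : ofList (v :: l) = pair v (ofList l) := rfl

theorem one_le_size (v : Val) : 1 ≤ v.size := by cases v <;> (simp [size]; try omega)

theorem size_fst_le (v : Val) : v.fst.size ≤ v.size := by
  cases v <;> (simp [fst, size]; try omega)

theorem size_snd_le (v : Val) : v.snd.size ≤ v.size := by
  cases v <;> (simp [snd, size]; try omega)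

@[simp] theorem isTrue_ofBool (b : Bool) : (ofBool b).IsTrue ↔ b = true := by
  cases b <;> simp [ofBool, IsTrue]

theorem size_ofBool_le (b : Bool) : (ofBool b).size ≤ 2 := by
  cases b <;> simp [ofBool]

theorem size_ofList (l : List Val) : (ofList l).size = 1 + (l.map fun v => 1 + v.size).sum := by
  induction l with
  | nil => simp
  | cons v l ih => simp [ih]; omega

theorem size_ofList_sublist_le {l₁ l₂ : List Val} (h : l₁.Sublist l₂) :
    (ofList l₁).size ≤ (ofList l₂).size := by
  simp only [size_ofList]
  have := (h.map fun v : Val => 1 + v.size).sum_le_sum (fun _ _ => Nat.zero_le _)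
  omega

theorem size_ofList_reverse (l : List Val) : (ofList l.reverse).size = (ofList l).size := by
  simp [size_ofList, List.sum_reverse]

theorem length_le_size_ofList (l : List Val) : l.length ≤ (ofList l).size := by
  induction l with
  | nil => simp
  | cons v l ih => simp; omega

theorem size_ofList_le {l : List Val} {B : ℕ} (h : ∀ v ∈ l, v.size ≤ B) :
    (ofList l).size ≤ 1 + l.length * (1 + B) := by
  induction l with
  | nil => simp
  | cons v l ih =>
    have h1 := ih fun w hw => h w (List.mem_cons_of_mem _ hw)
    have h2 := h v List.mem_cons_self
    simp only [ofList_cons, size_pair, List.length_cons, add_mul, one_mul]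
    omega

theorem size_mem_le {l : List Val} {v : Val} (h : v ∈ l) : v.size ≤ (ofList l).size := by
  induction l with
  | nil => simp at h
  | cons w l ih =>
    rcases List.mem_cons.1 h with rfl | h
    · simp; omega
    · have := ih h
      simp; omega

end Val

open Val

theorem natSize_add_le (a b : ℕ) : (a + b).size ≤ a.size + b.size + 1 := by
  rw [Nat.size_le]
  have h1 := Nat.lt_size_self a
  have h2 := Nat.lt_size_self b
  have h3 : 2 ^ a.size ≤ 2 ^ (a.size + b.size) := Nat.pow_le_pow_right (by omega) (by omega)
  have h4 : 2 ^ b.size ≤ 2 ^ (a.size + b.size) := Nat.pow_le_pow_right (by omega) (by omega)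
  rw [pow_succ]
  omega

theorem natSize_mul_le (a b : ℕ) : (a * b).size ≤ a.size + b.size := by
  rw [Nat.size_le, pow_add]
  exact Nat.mul_lt_mul'' (Nat.lt_size_self a) (Nat.lt_size_self b)

theorem size_add_le (a b : ℤ) : (int (a + b)).size ≤ (int a).size + (int b).size := by
  have h1 := Nat.size_le_size (Int.natAbs_add_le a b)
  have h2 := natSize_add_le a.natAbs b.natAbs
  simp only [size_int]
  omega

theorem size_sub_le (a b : ℤ) : (int (a - b)).size ≤ (int a).size + (int b).size := by
  have h1 := Nat.size_le_size (Int.natAbs_sub_le a b)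
  have h2 := natSize_add_le a.natAbs b.natAbs
  simp only [size_int]
  omega

theorem size_mul_le (a b : ℤ) : (int (a * b)).size ≤ (int a).size + (int b).size := by
  have h2 := natSize_mul_le a.natAbs b.natAbs
  simp only [size_int, Int.natAbs_mul]
  omega

theorem size_div_le (a b : ℤ) : (int (a / b)).size ≤ (int a).size + 1 := by
  have h := Nat.size_le_size (Int.natAbs_ediv_le_natAbs a b)
  simp only [size_int]
  omega

/-! ### Polynomial-time transformations of encoded data -/

/-- There is one program that, uniformly in the index `γ`, turns the value `e γ` into the value
`f γ` in time polynomial in the size of `e γ`. The program may be placed at any variable `k`: its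
input and output are in variable `k`, and it does not touch the variables below `k`. -/
def PolyTime {Γ : Type} (e f : Γ → Val) : Prop :=
  ∃ (c : ℕ → Cmd) (b : ℕ), ∀ (γ : Γ) (k : ℕ) (σ : State), σ k = e γ →
    ∃ (τ : State) (t : ℕ), Exec (c k) σ τ t ∧ τ k = f γ ∧ (∀ j < k, τ j = σ j) ∧
      t ≤ ((e γ).size + 2) ^ b ∧ (f γ).size ≤ ((e γ).size + 2) ^ b

namespace PolyTime

variable {Γ Δ : Type} {e f g : Γ → Val}

theorem sizeBdd (h : PolyTime e f) : PolyBdd (fun γ => (e γ).size) fun γ => (f γ).size := by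
  obtain ⟨c, b, h⟩ := h
  refine ⟨b, fun γ => ?_⟩
  obtain ⟨τ, t, -, -, -, -, h⟩ := h γ 0 (fun _ => e γ) rfl
  exact h

/-- Introduction rule with an arbitrary polynomially bounded running time. -/
theorem intro {T : Γ → ℕ} (c : ℕ → Cmd) (hT : PolyBdd (fun γ => (e γ).size) T)
    (hf : PolyBdd (fun γ => (e γ).size) fun γ => (f γ).size)
    (h : ∀ (γ : Γ) (k : ℕ) (σ : State), σ k = e γ →
      ∃ (τ : State) (t : ℕ), Exec (c k) σ τ t ∧ τ k = f γ ∧ (∀ j < k, τ j = σ j) ∧ t ≤ T γ) :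
    PolyTime e f := by
  obtain ⟨b, hb⟩ := hT.add hf
  refine ⟨c, b, fun γ k σ hσ => ?_⟩
  obtain ⟨τ, t, h1, h2, h3, h4⟩ := h γ k σ hσ
  have := hb γ
  simp only at this
  exact ⟨τ, t, h1, h2, h3, by omega, by omega⟩

/-- Elimination rule that exposes the running time as a function of the index. -/
theorem dest (h : PolyTime e f) : ∃ (c : ℕ → Cmd) (T : Γ → ℕ),
    PolyBdd (fun γ => (e γ).size) T ∧ ∀ (γ : Γ) (k : ℕ) (σ : State), σ k = e γ →
      ∃ (τ : State) (t : ℕ), Exec (c k) σ τ t ∧ τ k = f γ ∧ (∀ j < k, τ j = σ j) ∧ t ≤ T γ := by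
  obtain ⟨c, b, h⟩ := h
  refine ⟨c, fun γ => ((e γ).size + 2) ^ b, ⟨b, fun γ => le_rfl⟩, fun γ k σ hσ => ?_⟩
  obtain ⟨τ, t, h1, h2, h3, h4, -⟩ := h γ k σ hσ
  exact ⟨τ, t, h1, h2, h3, h4⟩

/-- Evaluation of an expression in the variable of the input. -/
theorem of_expr {T : Γ → ℕ} (ex : ℕ → Expr) (hT : PolyBdd (fun γ => (e γ).size) T)
    (hf : PolyBdd (fun γ => (e γ).size) fun γ => (f γ).size)
    (h : ∀ (γ : Γ) (k : ℕ) (σ : State), σ k = e γ →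
      (ex k).eval σ = f γ ∧ (ex k).cost σ ≤ T γ) : PolyTime e f := by
  refine intro (fun k => .assign k (ex k)) ((PolyBdd.const _ 1).add hT) hf fun γ k σ hσ => ?_
  obtain ⟨h1, h2⟩ := h γ k σ hσ
  refine ⟨_, _, Exec.assign k (ex k) σ, by simp [h1], fun j hj => ?_, by omega⟩
  rw [Function.update_of_ne hj.ne]

theorem refl (e : Γ → Val) : PolyTime e e :=
  of_expr (fun k => .var k) (.refl _) (.refl _) fun γ k σ hσ => by simp [Expr.eval, Expr.cost, hσ]

theorem const (e : Γ → Val) (a : ℤ) : PolyTime e fun _ => int a :=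
  of_expr (fun _ => .const a) (.const _ _) (.const _ _) fun _ _ _ _ => ⟨rfl, le_rfl⟩

theorem trans (hf : PolyTime e f) (hg : PolyTime f g) : PolyTime e g := by
  have hs := hf.sizeBdd.trans hg.sizeBdd
  have hs' := hf.sizeBdd
  obtain ⟨c, T, hT, hc⟩ := hf.dest
  obtain ⟨c', T', hT', hc'⟩ := hg.dest
  refine intro (fun k => .seq (c k) (c' k)) (hT.add (hs'.trans hT')) hs fun γ k σ hσ => ?_
  obtain ⟨τ, t, h1, h2, h3, h4⟩ := hc γ k σ hσ
  obtain ⟨τ', t', h1', h2', h3', h4'⟩ := hc' γ k τ h2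
  exact ⟨τ', _, .seq h1 h1', h2', fun j hj => (h3' j hj).trans (h3 j hj), by omega⟩

/-- Reindexing is how contexts are handled: a dependent sum over indices models a bound variable,
and a subtype models a branch condition, while the program stays the same. -/
theorem comap (h : PolyTime e f) (ρ : Δ → Γ) : PolyTime (fun δ => e (ρ δ)) fun δ => f (ρ δ) := by
  obtain ⟨c, b, h⟩ := h
  exact ⟨c, b, fun δ => h (ρ δ)⟩

theorem pair (hf : PolyTime e f) (hg : PolyTime e g) :
    PolyTime e fun γ => .pair (f γ) (g γ) := by
  have hsf := hf.sizeBdd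
  have hsg := hg.sizeBdd
  obtain ⟨c, T, hT, hc⟩ := hf.dest
  obtain ⟨c', T', hT', hc'⟩ := hg.dest
  have hs : PolyBdd (fun γ => (e γ).size) fun γ => (Val.pair (f γ) (g γ)).size :=
    ((PolyBdd.const _ 1).add hsf).add hsg
  -- Variable `k` keeps the input until the final assignment. The first result stays in `k + 1`, out
  -- of reach of the second program, which is placed at `k + 2`.
  refine intro (T := fun γ => 2 * (e γ).size + T γ + T' γ + ((f γ).size + (g γ).size +
      (Val.pair (f γ) (g γ)).size) + 3)
    (fun k => .seq (.assign (k + 1) (.var k)) (.seq (c (k + 1)) (.seq (.assign (k + 2) (.var k))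
      (.seq (c' (k + 2)) (.assign k (.pair (.var (k + 1)) (.var (k + 2)))))))) ?_ hs
    fun γ k σ hσ => ?_
  · exact ((((((PolyBdd.const _ 2).mul (.refl _)).add hT).add hT').add
      ((hsf.add hsg).add hs)).add (.const _ 3))
  · obtain ⟨τ, t, h1, h2, h3, h4⟩ := hc γ (k + 1) (Function.update σ (k + 1) (σ k)) (by simp [hσ])
    have hk : τ k = e γ := by
      rw [h3 k (by omega), Function.update_of_ne (by omega), hσ]
    obtain ⟨τ', t', h1', h2', h3', h4'⟩ :=
      hc' γ (k + 2) (Function.update τ (k + 2) (τ k)) (by simp [hk])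
    have hk1 : τ' (k + 1) = f γ := by
      rw [h3' (k + 1) (by omega), Function.update_of_ne (by omega), h2]
    refine ⟨_, _, .seq (.assign _ _ _) (.seq h1 (.seq (.assign _ _ _) (.seq h1' (.assign _ _ _)))),
      ?_, fun j hj => ?_, ?_⟩
    · simp [Expr.eval, hk1, h2']
    · rw [Function.update_of_ne hj.ne, h3' j (by omega), Function.update_of_ne (by omega),
        h3 j (by omega), Function.update_of_ne (by omega)]
    · simp only [Expr.cost, Expr.eval, hk1, h2', hk, hσ]
      omega

theorem fst (hf : PolyTime e f) : PolyTime e fun γ => (f γ).fst :=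
  hf.trans <| of_expr (T := fun γ => (f γ).size + (f γ).size) (fun k => .fst (.var k))
    ((PolyBdd.refl _).add (.refl _)) (.of_le fun γ => size_fst_le _) fun γ k σ hσ => by
      have := size_fst_le (f γ)
      simp [Expr.eval, Expr.cost, hσ, this]

theorem snd (hf : PolyTime e f) : PolyTime e fun γ => (f γ).snd :=
  hf.trans <| of_expr (T := fun γ => (f γ).size + (f γ).size) (fun k => .snd (.var k))
    ((PolyBdd.refl _).add (.refl _)) (.of_le fun γ => size_snd_le _) fun γ k σ hσ => by
      have := size_snd_le (f γ)
      simp [Expr.eval, Expr.cost, hσ, this]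

theorem left {u v : Γ → Val} (hf : PolyTime e fun γ => .pair (u γ) (v γ)) : PolyTime e u := hf.fst

theorem right {u v : Γ → Val} (hf : PolyTime e fun γ => .pair (u γ) (v γ)) : PolyTime e v := hf.snd

/-- Use of a transformation in a context that has been extended by a further value. -/
theorem lift (h : PolyTime e f) (ρ : Δ → Γ) (w : Δ → Val) :
    PolyTime (fun δ => .pair (e (ρ δ)) (w δ)) fun δ => f (ρ δ) :=
  (refl fun δ => Val.pair (e (ρ δ)) (w δ)).left.trans (h.comap ρ)

/-- Common pattern of the binary operations: both operands are packed into one pair, and by `hsize`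
the result is no larger than that pair, so the evaluation cost is linear in its size. -/
theorem of_pair_expr {h : Γ → Val} (ex : Expr → Expr → Expr) (hf : PolyTime e f) (hg : PolyTime e g)
    (hev : ∀ σ x y γ, Expr.eval σ x = f γ → Expr.eval σ y = g γ → (ex x y).eval σ = h γ)
    (hcost : ∀ σ x y, (ex x y).cost σ = x.cost σ + y.cost σ + ((ex x y).eval σ).size)
    (hsize : ∀ γ, (h γ).size ≤ (f γ).size + (g γ).size + 1) : PolyTime e h := by
  refine (hf.pair hg).trans (of_expr
    (T := fun γ => 4 * (Val.pair (f γ) (g γ)).size + (Val.pair (f γ) (g γ)).size)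
    (fun k => ex (.fst (.var k)) (.snd (.var k)))
    (((PolyBdd.const _ 4).mul (.refl _)).add (.refl _))
    (.of_le fun γ => ?_) fun γ k σ hσ => ?_)
  · have := hsize γ
    simp; omega
  · have h1 := hev σ (.fst (.var k)) (.snd (.var k)) γ (by simp [Expr.eval, hσ])
      (by simp [Expr.eval, hσ])
    refine ⟨h1, ?_⟩
    have := hsize γ
    rw [hcost, h1]
    simp [Expr.cost, Expr.eval, hσ]
    omega

variable {a b : Γ → ℤ}

theorem add (ha : PolyTime e fun γ => int (a γ)) (hb : PolyTime e fun γ => int (b γ)) :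
    PolyTime e fun γ => int (a γ + b γ) :=
  of_pair_expr .plus ha hb (fun σ x y γ hx hy => by simp [Expr.eval, hx, hy]) (fun _ _ _ => rfl)
    fun γ => by have := size_add_le (a γ) (b γ); omega

theorem sub (ha : PolyTime e fun γ => int (a γ)) (hb : PolyTime e fun γ => int (b γ)) :
    PolyTime e fun γ => int (a γ - b γ) :=
  of_pair_expr .minus ha hb (fun σ x y γ hx hy => by simp [Expr.eval, hx, hy]) (fun _ _ _ => rfl)
    fun γ => by have := size_sub_le (a γ) (b γ); omega

theorem mul (ha : PolyTime e fun γ => int (a γ)) (hb : PolyTime e fun γ => int (b γ)) :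
    PolyTime e fun γ => int (a γ * b γ) :=
  of_pair_expr .times ha hb (fun σ x y γ hx hy => by simp [Expr.eval, hx, hy]) (fun _ _ _ => rfl)
    fun γ => by have := size_mul_le (a γ) (b γ); omega

theorem div (ha : PolyTime e fun γ => int (a γ)) (hb : PolyTime e fun γ => int (b γ)) :
    PolyTime e fun γ => int (a γ / b γ) :=
  of_pair_expr .quot ha hb (fun σ x y γ hx hy => by simp [Expr.eval, hx, hy]) (fun _ _ _ => rfl)
    fun γ => by have := size_div_le (a γ) (b γ); omega

theorem le (ha : PolyTime e fun γ => int (a γ)) (hb : PolyTime e fun γ => int (b γ)) :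
    PolyTime e fun γ => ofBool (decide (a γ ≤ b γ)) :=
  of_pair_expr .le ha hb (fun σ x y γ hx hy => by simp [Expr.eval, hx, hy]) (fun _ _ _ => rfl)
    fun γ => by
      have := size_ofBool_le (decide (a γ ≤ b γ))
      have := one_le_size (int (a γ))
      have := one_le_size (int (b γ))
      omega

theorem neg (ha : PolyTime e fun γ => int (a γ)) : PolyTime e fun γ => int (-a γ) := by
  simpa using (const e 0).sub ha

/-- Branching on the truth of a value. -/
theorem branch {t : Γ → Val} {p : Γ → Prop} (ht : PolyTime e t) (hp : ∀ γ, (t γ).IsTrue ↔ p γ)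
    (h₁ : PolyTime (fun x : {γ // p γ} => e x) fun x => f x)
    (h₂ : PolyTime (fun x : {γ // ¬ p γ} => e x) fun x => f x) : PolyTime e f := by
  classical
  have hst := ht.sizeBdd
  obtain ⟨b₁, hb₁⟩ := h₁.sizeBdd
  obtain ⟨b₂, hb₂⟩ := h₂.sizeBdd
  obtain ⟨c, T, hT, hc⟩ := ht.dest
  obtain ⟨c₁, d₁, hc₁⟩ := h₁
  obtain ⟨c₂, d₂, hc₂⟩ := h₂
  refine intro (T := fun γ => (e γ).size + T γ + (t γ).size + ((e γ).size + 2) ^ d₁ +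
      ((e γ).size + 2) ^ d₂ + 2) (fun k => .seq (.assign (k + 1) (.var k))
        (.seq (c (k + 1)) (.ite (.var (k + 1)) (c₁ k) (c₂ k)))) ?_ ?_ fun γ k σ hσ => ?_
  · exact (((((PolyBdd.refl _).add hT).add hst).add ⟨d₁, fun _ => le_rfl⟩).add
      ⟨d₂, fun _ => le_rfl⟩).add (.const _ 2)
  -- Each branch bounds the output only where it is taken; the sum of the two bounds works
  -- everywhere.
  · refine (PolyBdd.add ⟨b₁, fun _ => le_rfl⟩ ⟨b₂, fun _ => le_rfl⟩).mono fun γ => ?_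
    by_cases h : p γ
    · have := hb₁ ⟨γ, h⟩
      simp only at this
      omega
    · have := hb₂ ⟨γ, h⟩
      simp only at this
      omega
  · obtain ⟨τ, s, h1, h2, h3, h4⟩ := hc γ (k + 1) (Function.update σ (k + 1) (σ k)) (by simp [hσ])
    have hlow : ∀ j < k + 1, τ j = σ j := fun j hj => by
      rw [h3 j hj, Function.update_of_ne hj.ne]
    have hk : τ k = e γ := (hlow k (by omega)).trans hσ
    by_cases h : p γ
    · obtain ⟨ρ, s', h1', h2', h3', h4', -⟩ := hc₁ ⟨γ, h⟩ k τ hk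
      refine ⟨ρ, _, .seq (.assign _ _ _) (.seq h1 (.ite_true ?_ h1')), h2',
        fun j hj => (h3' j hj).trans (hlow j (by omega)), ?_⟩
      · simpa [Expr.eval, h2] using (hp γ).2 h
      · simp only [Expr.cost, h2, hσ] at h4' ⊢
        omega
    · obtain ⟨ρ, s', h1', h2', h3', h4', -⟩ := hc₂ ⟨γ, h⟩ k τ hk
      refine ⟨ρ, _, .seq (.assign _ _ _) (.seq h1 (.ite_false ?_ h1')), h2',
        fun j hj => (h3' j hj).trans (hlow j (by omega)), ?_⟩
      · simpa [Expr.eval, h2] using fun h' => h ((hp γ).1 h')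
      · simp only [Expr.cost, h2, hσ] at h4' ⊢
        omega

theorem congr {f' : Γ → Val} (h : PolyTime e f) (hf : ∀ γ, f γ = f' γ) : PolyTime e f' :=
  (funext hf : f = f') ▸ h

theorem ite {b : Γ → Bool} (hb : PolyTime e fun γ => ofBool (b γ)) (hf : PolyTime e f)
    (hg : PolyTime e g) : PolyTime e fun γ => if b γ then f γ else g γ :=
  hb.branch (p := fun γ => b γ = true) (fun γ => isTrue_ofBool _)
    ((hf.comap Subtype.val).congr fun γ => by simp [γ.2])
    ((hg.comap Subtype.val).congr fun γ => by simp [γ.2])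

theorem ite_int {b : Γ → Bool} {x y : Γ → ℤ} (hb : PolyTime e fun γ => ofBool (b γ))
    (hx : PolyTime e fun γ => int (x γ)) (hy : PolyTime e fun γ => int (y γ)) :
    PolyTime e fun γ => int (if b γ then x γ else y γ) :=
  (hb.ite hx hy).congr fun γ => by split <;> rfl

theorem ite_bool {b x y : Γ → Bool} (hb : PolyTime e fun γ => ofBool (b γ))
    (hx : PolyTime e fun γ => ofBool (x γ)) (hy : PolyTime e fun γ => ofBool (y γ)) :
    PolyTime e fun γ => ofBool (if b γ then x γ else y γ) :=
  (hb.ite hx hy).congr fun γ => by split <;> rfl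

theorem bool_const (e : Γ → Val) (b : Bool) : PolyTime e fun _ => ofBool b := const e _

theorem not {x : Γ → Bool} (hx : PolyTime e fun γ => ofBool (x γ)) :
    PolyTime e fun γ => ofBool (!x γ) :=
  (hx.ite (bool_const e false) (bool_const e true)).congr fun γ => by cases x γ <;> rfl

theorem and {x y : Γ → Bool} (hx : PolyTime e fun γ => ofBool (x γ))
    (hy : PolyTime e fun γ => ofBool (y γ)) : PolyTime e fun γ => ofBool (x γ && y γ) :=
  (hx.ite hy (bool_const e false)).congr fun γ => by cases x γ <;> rfl

theorem or {x y : Γ → Bool} (hx : PolyTime e fun γ => ofBool (x γ))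
    (hy : PolyTime e fun γ => ofBool (y γ)) : PolyTime e fun γ => ofBool (x γ || y γ) :=
  (hx.ite (bool_const e true) hy).congr fun γ => by cases x γ <;> rfl

theorem lt (ha : PolyTime e fun γ => int (a γ)) (hb : PolyTime e fun γ => int (b γ)) :
    PolyTime e fun γ => ofBool (decide (a γ < b γ)) :=
  (hb.le ha).not.congr fun γ => congrArg ofBool (by rw [← decide_not]; simp only [not_le])

theorem eq (ha : PolyTime e fun γ => int (a γ)) (hb : PolyTime e fun γ => int (b γ)) :
    PolyTime e fun γ => ofBool (decide (a γ = b γ)) :=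
  ((ha.le hb).and (hb.le ha)).congr fun γ => by
    rw [← Bool.decide_and]
    exact congrArg _ (decide_eq_decide.2 (le_antisymm_iff.symm))

/-- The rule for loops: `s γ i` is the state before the `i`-th iteration, and the loop goes on as
long as the first component of the state is not the leaf `0`. -/
theorem loop {N : Γ → ℕ} {s : Γ → ℕ → Val} (h₀ : PolyTime e fun γ => s γ 0)
    (htrue : ∀ γ i, i < N γ → (s γ i).fst ≠ int 0) (hfalse : ∀ γ, (s γ (N γ)).fst = int 0)
    (hN : PolyBdd (fun γ => (e γ).size) N)
    (hs : PolyBdd (fun x : Σ γ, Fin (N γ + 1) => (e x.1).size) fun x => (s x.1 x.2).size)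
    (hstep : PolyTime (fun x : Σ γ, Fin (N γ) => s x.1 x.2) fun x => s x.1 (x.2 + 1)) :
    PolyTime e fun γ => s γ (N γ) := by
  obtain ⟨b, hb⟩ := hs
  have hb' : ∀ γ i, i ≤ N γ → (s γ i).size ≤ ((e γ).size + 2) ^ b := fun γ i hi =>
    hb ⟨γ, ⟨i, by omega⟩⟩
  obtain ⟨c₀, T₀, hT₀, hc₀⟩ := h₀.dest
  obtain ⟨c, d, hc⟩ := hstep
  -- The uniform bound on the intermediate states is a hypothesis, because iterating a polynomial
  -- size bound `N γ` times need not give a polynomial.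
  let S : Γ → ℕ := fun γ => ((e γ).size + 2) ^ b
  have hS : PolyBdd (fun γ => (e γ).size) S := ⟨b, fun _ => le_rfl⟩
  -- Cost of one round: evaluating the guard takes at most `1 + 2 * S`, the body at most `(S + 2) ^
  -- d`.
  let W : Γ → ℕ := fun γ => 1 + 2 * S γ + (S γ + 2) ^ d
  have hW : PolyBdd (fun γ => (e γ).size) W :=
    ((PolyBdd.const _ 1).add ((PolyBdd.const _ 2).mul hS)).add (hS.trans ⟨d, fun _ => le_rfl⟩)
  refine intro (T := fun γ => T₀ γ + (N γ + 1) * W γ)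
    (fun k => .seq (c₀ k) (.loop (.fst (.var k)) (c k)))
    (hT₀.add ((hN.add (.const _ 1)).mul hW)) (hS.mono fun γ => hb' γ _ le_rfl) fun γ k σ hσ => ?_
  obtain ⟨τ, t, h1, h2, h3, h4⟩ := hc₀ γ k σ hσ
  -- Induction on the number `j` of remaining iterations; the last test of the guard accounts for
  -- the summand 1 in `j + 1`.
  have key : ∀ j, j ≤ N γ → ∀ τ : State, τ k = s γ (N γ - j) →
      ∃ (ρ : State) (t : ℕ), Exec (.loop (.fst (.var k)) (c k)) τ ρ t ∧ ρ k = s γ (N γ) ∧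
        (∀ i < k, ρ i = τ i) ∧ t ≤ (j + 1) * W γ := by
    intro j
    induction j with
    | zero =>
      intro _ τ hτ
      simp only [Nat.sub_zero] at hτ
      refine ⟨τ, _, .loop_false ?_, hτ, fun _ _ => rfl, ?_⟩
      · simp [Expr.eval, hτ, hfalse, IsTrue]
      · have h5 := hb' γ (N γ) le_rfl
        have h6 := size_fst_le (s γ (N γ))
        simp only [Expr.cost, Expr.eval, hτ, W, S]
        omega
    | succ j ih =>
      intro hj τ hτ
      obtain ⟨τ', t', h1', h2', h3', h4', -⟩ := hc ⟨γ, ⟨N γ - (j + 1), by omega⟩⟩ k τ hτ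
      have hj' : N γ - (j + 1) + 1 = N γ - j := by omega
      simp only [hj'] at h2'
      obtain ⟨ρ, t, h1, h2, h3, h4⟩ := ih (by omega) τ' h2'
      refine ⟨ρ, _, .loop_true ?_ h1' h1, h2, fun i hi => (h3 i hi).trans (h3' i hi), ?_⟩
      · simpa [Expr.eval, hτ, IsTrue] using htrue γ (N γ - (j + 1)) (by omega)
      · have h5 := hb' γ (N γ - (j + 1)) (by omega)
        have h6 := size_fst_le (s γ (N γ - (j + 1)))
        have h10 : S γ = ((e γ).size + 2) ^ b := rfl
        have h7 : ((s γ (N γ - (j + 1))).size + 2) ^ d ≤ (S γ + 2) ^ d :=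
          Nat.pow_le_pow_left (by omega) d
        simp only [Expr.cost, Expr.eval, hτ]
        have h8 : (j + 1 + 1) * W γ = (j + 1) * W γ + W γ := by ring
        have h9 : W γ = 1 + 2 * S γ + (S γ + 2) ^ d := rfl
        simp only at h4'
        omega
  obtain ⟨ρ, t', h1', h2', h3', h4'⟩ := key (N γ) le_rfl τ (by simpa using h2)
  exact ⟨ρ, _, .seq h1 h1', h2', fun j hj => (h3' j hj).trans (h3 j hj), by omega⟩

/-- A polynomial-time transformation solves the corresponding search problem. -/
theorem solvable {α : Type} {β : α → Type} {encIn : α → Val} {encOut : ∀ a, β a → Val}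
    {spec : ∀ a, β a → Prop} (ans : ∀ a, β a) (h : PolyTime encIn fun a => encOut a (ans a))
    (hans : ∀ a, spec a (ans a)) : SolvableInPolyTime encIn encOut spec := by
  obtain ⟨c, b, h⟩ := h
  refine ⟨c 0, (Polynomial.X + 2) ^ b, fun a => ?_⟩
  obtain ⟨τ, t, h1, h2, -, h4, -⟩ := h a 0 (initState (encIn a)) (by simp [initState])
  exact ⟨ans a, t, ⟨τ, h1, h2⟩, by simpa using h4, hans a⟩

end PolyTime

end While

/-! ### Iteration over lists and binary digits, search, sums and products. -/

namespace While

open Val ANF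

theorem size_encNat_le (i : ℕ) : (encNat i).size ≤ 1 + i := by
  have : i.size ≤ i := Nat.size_le.2 Nat.lt_two_pow_self
  simp [encNat, this]

theorem size_encFun_le {r B : ℕ} {w : Fin r → Val} (h : ∀ i, (w i).size ≤ B) :
    (encFun w).size ≤ 1 + r * (1 + B) := by
  have := size_ofList_le (l := List.ofFn w) (B := B) (by simpa [List.mem_ofFn] using h)
  simpa [encFun] using this

theorem le_size_encFun {r : ℕ} (w : Fin r → Val) : r ≤ (encFun w).size := by
  simpa [encFun] using length_le_size_ofList (List.ofFn w)

theorem size_le_size_encFun {r : ℕ} (w : Fin r → Val) (i : Fin r) :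
    (w i).size ≤ (encFun w).size :=
  size_mem_le (by simp [List.mem_ofFn])

namespace PolyTime

variable {Γ : Type} {e f : Γ → Val} {r : Γ → ℕ} {w : ∀ γ, Fin (r γ) → Val}

theorem length_bdd (hw : PolyTime e fun γ => encFun (w γ)) : PolyBdd (fun γ => (e γ).size) r :=
  hw.sizeBdd.mono fun γ => le_size_encFun (w γ)

/-- Iteration over the indices of a list: `a γ i` is the accumulator before step `i`. -/
theorem fold {a : Γ → ℕ → Val} (hw : PolyTime e fun γ => encFun (w γ))
    (h₀ : PolyTime e fun γ => a γ 0)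
    (ha : PolyBdd (fun x : Σ γ, Fin (r γ + 1) => (e x.1).size) fun x => (a x.1 x.2).size)
    (hstep : PolyTime (fun x : Σ γ, Fin (r γ) => .pair (e x.1) (.pair (encNat x.2) (a x.1 x.2)))
      fun x => a x.1 (x.2 + 1)) : PolyTime e fun γ => a γ (r γ) := by
  -- The unread suffix of the list is the guard: a nonempty list is a pair, and the empty one is the
  -- leaf `0`. The context `e γ` travels along so that the loop body can use it.
  let s : Γ → ℕ → Val := fun γ i =>
    .pair (ofList ((List.ofFn (w γ)).drop i)) (.pair (e γ) (.pair (encNat i) (a γ i)))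
  have hs : PolyTime e fun γ => s γ (r γ) := by
    refine loop ?_ ?_ ?_ hw.length_bdd ?_ ?_
    · exact (hw.congr fun γ => by simp [encFun]).pair ((refl e).pair ((const e 0).pair h₀))
    · intro γ i hi
      simp only [s, fst_pair]
      rw [List.drop_eq_getElem_cons (by simpa using hi)]
      simp
    · intro γ
      simp only [s, fst_pair]
      rw [List.drop_of_length_le (by simp)]
      rfl
    · refine ((((hw.sizeBdd.comap Sigma.fst).add (.refl _)).add
        (hw.length_bdd.comap Sigma.fst)).add (ha.add (.const _ 4))).mono fun x => ?_
      have h1 := size_encNat_le x.2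
      have h2 := size_ofList_sublist_le (List.drop_sublist (x.2 : ℕ) (List.ofFn (w x.1)))
      have h3 := x.2.2
      simp only [s, size_pair, encFun]
      omega
    · have h := refl fun x : Σ γ, Fin (r γ) => s x.1 x.2
      refine .pair (h.left.snd.congr fun x => ?_)
        (h.right.left.pair (.pair (h.right.right.left.add (const _ 1)) (h.right.trans hstep)))
      rw [List.drop_eq_getElem_cons (by simp)]
      rfl
  exact hs.right.right.right

/-- Selection of an entry of a list. -/
theorem get {i : ∀ γ, Fin (r γ)} (hw : PolyTime e fun γ => encFun (w γ))
    (hi : PolyTime e fun γ => encNat (i γ)) : PolyTime e fun γ => w γ (i γ) := by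
  -- Entries are dropped until `i γ` of them are gone; after that the list stays unchanged and its
  -- head is the wanted entry.
  let a : Γ → ℕ → Val := fun γ j => ofList ((List.ofFn (w γ)).drop (min j (i γ)))
  have ha : PolyTime e fun γ => a γ (r γ) := by
    refine fold hw (hw.congr fun γ => by simp [a, encFun]) ?_ ?_
    · exact (hw.sizeBdd.comap Sigma.fst).mono fun x =>
        size_ofList_sublist_le (List.drop_sublist _ _)
    · have h := refl fun x : Σ γ, Fin (r γ) =>
        Val.pair (e x.1) (.pair (encNat x.2) (a x.1 x.2))
      have hi' := h.left.trans (hi.comap Sigma.fst)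
      refine ((lt h.right.left hi').ite h.right.right.snd h.right.right).congr fun x => ?_
      simp only [a, Nat.cast_lt, decide_eq_true_eq]
      split
      · rename_i hlt
        rw [min_eq_left hlt.le, min_eq_left (by omega), List.drop_eq_getElem_cons (by simp)]
        rfl
      · rw [min_eq_right (by omega), min_eq_right (by omega)]
  refine ha.fst.congr fun γ => ?_
  simp only [a]
  rw [min_eq_right (i γ).2.le, List.drop_eq_getElem_cons (by simp)]
  simp

/-- Lists grow only at the front, so a list built during a loop comes out reversed and has to be
turned around. The accumulator holds the unread suffix and the reversed prefix. -/
theorem reverse {l : Γ → List Val} (h : PolyTime e fun γ => ofList (l γ)) :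
    PolyTime e fun γ => ofList (l γ).reverse := by
  let a : Γ → ℕ → Val := fun γ i =>
    .pair (ofList ((l γ).drop i)) (ofList ((l γ).take i).reverse)
  have hl : PolyTime e fun γ => encFun (l γ).get := h.congr fun γ => by simp [encFun]
  have ha : PolyTime e fun γ => a γ (l γ).length := by
    refine fold hl ((h.pair (const e 0)).congr fun γ => by simp [a]) ?_ ?_
    · refine (((h.sizeBdd.add h.sizeBdd).add (.const _ 1)).comap Sigma.fst).mono fun x => ?_
      have h1 := size_ofList_sublist_le (List.drop_sublist (x.2 : ℕ) (l x.1))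
      have h2 := size_ofList_sublist_le (List.take_sublist (x.2 : ℕ) (l x.1))
      simp only [a, size_pair, size_ofList_reverse]
      omega
    · have h := (refl fun x : Σ γ, Fin (l γ).length =>
        Val.pair (e x.1) (.pair (encNat x.2) (a x.1 x.2))).right.right
      refine (h.left.snd.pair (h.left.fst.pair h.right)).congr fun x => ?_
      simp only [a]
      rw [List.take_succ_eq_append_getElem x.2.2, List.drop_eq_getElem_cons x.2.2]
      simp only [ofList_cons, snd_pair, fst_pair, List.reverse_append, List.reverse_cons,
        List.reverse_nil, List.nil_append, List.singleton_append]
  exact ha.right.congr fun γ => by simp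

/-- Construction of a list from a computation of its entries. -/
theorem tab {g : ∀ γ, Fin (r γ) → Val} (hw : PolyTime e fun γ => encFun (w γ))
    (hg : PolyTime (fun x : Σ γ, Fin (r γ) => .pair (e x.1) (encNat x.2)) fun x => g x.1 x.2) :
    PolyTime e fun γ => encFun (g γ) := by
  let a : Γ → ℕ → Val := fun γ i => ofList ((List.ofFn (g γ)).take i).reverse
  -- An index is smaller than the length `r`, which the size of the given list bounds. Hence each
  -- entry is polynomially bounded in the size of `e` alone, uniformly in the index.
  have hidx : PolyBdd (fun x : Σ γ, Fin (r γ) => (e x.1).size) fun x =>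
      (Val.pair (e x.1) (encNat x.2)).size :=
    ((PolyBdd.refl _).add ((hw.length_bdd.comap Sigma.fst).add (.const _ 2))).mono fun x => by
      have h1 := size_encNat_le x.2
      have h2 := x.2.2
      simp only [size_pair]
      omega
  obtain ⟨b, hb⟩ := hidx.trans hg.sizeBdd
  have hfun : PolyBdd (fun γ => (e γ).size) fun γ => (encFun (g γ)).size :=
    ((PolyBdd.const _ 1).add (hw.length_bdd.mul ((PolyBdd.const _ 1).add
      ⟨b, fun _ => le_rfl⟩))).mono fun γ => size_encFun_le fun i => hb ⟨γ, i⟩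
  have ha : PolyTime e fun γ => a γ (r γ) := by
    refine fold hw ((const e 0).congr fun γ => by simp [a]) ?_ ?_
    · refine (hfun.comap Sigma.fst).mono fun x => ?_
      simp only [a, size_ofList_reverse]
      exact size_ofList_sublist_le (List.take_sublist _ _)
    · have h := refl fun x : Σ γ, Fin (r γ) => Val.pair (e x.1) (.pair (encNat x.2) (a x.1 x.2))
      refine (((h.left.pair h.right.left).trans hg).pair h.right.right).congr fun x => ?_
      simp only [a]
      rw [List.take_succ_eq_append_getElem (by simp)]
      simp
  refine ha.reverse.congr fun γ => ?_
  rw [List.reverse_reverse, List.take_of_length_le (by simp)]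
  rfl

/-- Search for the first index with a given property. -/
theorem find {p : ∀ γ, Fin (r γ) → Bool} (hw : PolyTime e fun γ => encFun (w γ))
    (hp : PolyTime (fun x : Σ γ, Fin (r γ) => .pair (e x.1) (encNat x.2))
      fun x => ofBool (p x.1 x.2)) :
    PolyTime e fun γ =>
      encOption (fun i : Fin (r γ) => encNat i) ((List.finRange (r γ)).find? (p γ)) := by
  let a : Γ → ℕ → Val := fun γ i =>
    encOption (fun i : Fin (r γ) => encNat i) (((List.finRange (r γ)).take i).find? (p γ))
  have ha : PolyTime e fun γ => a γ (r γ) := by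
    refine fold hw ((const e 0).congr fun γ => by simp [a, encOption]) ?_ ?_
    · refine ((hw.length_bdd.add (.const _ 4)).comap Sigma.fst).mono fun x => ?_
      simp only [a]
      rcases ((List.finRange (r x.1)).take x.2).find? (p x.1) with _ | j
      · simp [encOption]
      · have h1 := size_encNat_le j
        have h2 := j.2
        have h3 : (int 1).size = 2 := rfl
        simp only [encOption, size_pair]
        omega
    · have h := refl fun x : Σ γ, Fin (r γ) => Val.pair (e x.1) (.pair (encNat x.2) (a x.1 x.2))
      have hp' := (h.left.pair h.right.left).trans hp
      -- The accumulator itself is the test, since `none` is encoded by the leaf `0`, the only false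
      -- value.
      refine h.right.right.branch (p := fun x => (((List.finRange (r x.1)).take x.2).find?
        (p x.1)).isSome) (fun x => ?_) ?_ ?_
      · simp only [a, IsTrue]
        rcases ((List.finRange (r x.1)).take x.2).find? (p x.1) with _ | j <;> simp [encOption]
      · refine (h.right.right.comap Subtype.val).congr fun x => ?_
        obtain ⟨j, hj⟩ := Option.isSome_iff_exists.1 x.2
        simp only [a]
        rw [List.take_succ_eq_append_getElem (by simp), List.find?_append, hj]
        rfl
      · refine ((hp'.ite ((const _ 1).pair h.right.left) (const _ 0)).comap Subtype.val).congr
          fun x => ?_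
        have hx := x.2
        rw [Option.not_isSome_iff_eq_none] at hx
        simp only [a]
        rw [List.take_succ_eq_append_getElem (by simp), List.find?_append, hx]
        cases hpx : p x.1.1 x.1.2 <;> simp [hpx, encOption]
  refine ha.congr fun γ => ?_
  simp only [a]
  rw [List.take_of_length_le (by simp)]

/-- Case distinction on an optional value. -/
theorem option_cases {α : Γ → Type} {enc : ∀ γ, α γ → Val} {o : ∀ γ, Option (α γ)}
    (ho : PolyTime e fun γ => encOption (enc γ) (o γ))
    (hn : PolyTime (fun x : {γ // o γ = none} => e x) fun x => f x)
    (hs : PolyTime (fun x : {x : Σ γ, α γ // o x.1 = some x.2} =>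
      .pair (e x.1.1) (enc x.1.1 x.1.2)) fun x => f x.1.1) : PolyTime e f := by
  refine ho.branch (p := fun γ => ¬ o γ = none) (fun γ => ?_) ?_ ?_
  · cases h : o γ <;> simp [encOption, IsTrue]
  -- On this branch the second component of the encoded option is the payload, so the context of
  -- `hs` can be built.
  · let ρ : {γ // ¬ o γ = none} → {x : Σ γ, α γ // o x.1 = some x.2} := fun γ =>
      ⟨⟨γ, (o γ).get (Option.isSome_iff_ne_none.2 γ.2)⟩, by simp⟩
    refine (((refl e).pair ho.snd).comap Subtype.val).trans ?_
    have : (fun δ : {γ // ¬ o γ = none} => Val.pair (e δ) (encOption (enc δ) (o δ)).snd) =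
        fun δ => .pair (e (ρ δ).1.1) (enc (ρ δ).1.1 (ρ δ).1.2) := by
      funext δ
      have h1 : o δ = some ((o δ).get (Option.isSome_iff_ne_none.2 δ.2)) := by simp
      rw [h1]
      rfl
    rw [this]
    exact hs.comap ρ
  · exact hn.comap fun x : {γ // ¬ ¬ o γ = none} => ⟨x.1, not_not.1 x.2⟩

theorem any {p : ∀ γ, Fin (r γ) → Bool} (hw : PolyTime e fun γ => encFun (w γ))
    (hp : PolyTime (fun x : Σ γ, Fin (r γ) => .pair (e x.1) (encNat x.2))
      fun x => ofBool (p x.1 x.2)) :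
    PolyTime e fun γ => ofBool ((List.finRange (r γ)).any (p γ)) := by
  refine (hw.find hp).option_cases (f := fun γ => ofBool ((List.finRange (r γ)).any (p γ)))
    ((bool_const _ false).congr fun x => ?_)
    ((bool_const _ true).congr fun x => ?_)
  · have h := x.2
    rw [List.find?_eq_none] at h
    exact congrArg ofBool (by simpa using h)
  · have h := List.find?_some x.2
    exact congrArg ofBool (by simpa using ⟨_, h⟩)

theorem sum {h : ∀ γ, Fin (r γ) → ℤ} (hw : PolyTime e fun γ => encFun (w γ))
    (hh : PolyTime (fun x : Σ γ, Fin (r γ) => .pair (e x.1) (encNat x.2))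
      fun x => int (h x.1 x.2)) :
    PolyTime e fun γ => int (∑ i, h γ i) := by
  have ht := hw.tab (g := fun γ i => int (h γ i)) hh
  let a : Γ → ℕ → Val := fun γ i => int ((List.ofFn (h γ)).take i).sum
  -- Bit size is subadditive, so every partial sum is no larger than the list of summands.
  have hsize : ∀ l : List ℤ, (int l.sum).size ≤ (ofList (l.map int)).size := fun l => by
    induction l with
    | nil => simp
    | cons x l ih =>
      have := size_add_le x l.sum
      simp only [List.sum_cons, List.map_cons, ofList_cons, size_pair]
      omega
  have ha : PolyTime e fun γ => a γ (r γ) := by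
    refine fold hw ((const e 0).congr fun γ => by simp [a]) ?_ ?_
    · refine (ht.sizeBdd.comap Sigma.fst).mono fun x => (hsize _).trans ?_
      rw [List.map_take]
      refine (size_ofList_sublist_le (List.take_sublist _ _)).trans ?_
      rw [List.map_ofFn]
      rfl
    · have h := refl fun x : Σ γ, Fin (r γ) => Val.pair (e x.1) (.pair (encNat x.2) (a x.1 x.2))
      refine (h.right.right.add ((h.left.pair h.right.left).trans hh)).congr fun x => ?_
      simp only [a]
      rw [List.take_succ_eq_append_getElem (by simp)]
      simp
  refine ha.congr fun γ => ?_
  simp only [a]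
  rw [List.take_of_length_le (by simp), List.sum_ofFn]

theorem prod {h : ∀ γ, Fin (r γ) → ℤ} (hw : PolyTime e fun γ => encFun (w γ))
    (hh : PolyTime (fun x : Σ γ, Fin (r γ) => .pair (e x.1) (encNat x.2))
      fun x => int (h x.1 x.2)) :
    PolyTime e fun γ => int (∏ i, h γ i) := by
  have ht := hw.tab (g := fun γ i => int (h γ i)) hh
  let a : Γ → ℕ → Val := fun γ i => int ((List.ofFn (h γ)).take i).prod
  -- The bits of a product add up at most; the extra 1 is for the empty product, since `int 1` has
  -- size 2 and the empty list size 1.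
  have hsize : ∀ l : List ℤ, (int l.prod).size ≤ (ofList (l.map int)).size + 1 := fun l => by
    induction l with
    | nil => simp
    | cons x l ih =>
      have := size_mul_le x l.prod
      simp only [List.prod_cons, List.map_cons, ofList_cons, size_pair]
      omega
  have ha : PolyTime e fun γ => a γ (r γ) := by
    refine fold hw ((const e 1).congr fun γ => by simp [a]) ?_ ?_
    · refine ((ht.sizeBdd.add (.const _ 1)).comap Sigma.fst).mono fun x => (hsize _).trans ?_
      rw [List.map_take]
      refine Nat.add_le_add_right ((size_ofList_sublist_le (List.take_sublist _ _)).trans ?_) 1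
      rw [List.map_ofFn]
      rfl
    · have h := refl fun x : Σ γ, Fin (r γ) => Val.pair (e x.1) (.pair (encNat x.2) (a x.1 x.2))
      refine (h.right.right.mul ((h.left.pair h.right.left).trans hh)).congr fun x => ?_
      simp only [a]
      rw [List.take_succ_eq_append_getElem (by simp)]
      simp
  refine ha.congr fun γ => ?_
  simp only [a]
  rw [List.take_of_length_le (by simp), List.prod_ofFn]

/-- Iteration over the binary digits of a number: before step `i` the number has been halved `i`
times. -/
theorem halving {u : Γ → ℕ} {a : Γ → ℕ → Val} (hu : PolyTime e fun γ => encNat (u γ))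
    (h₀ : PolyTime e fun γ => a γ 0)
    (ha : PolyBdd (fun x : Σ γ, Fin ((u γ).size + 1) => (e x.1).size) fun x => (a x.1 x.2).size)
    (hstep : PolyTime (fun x : Σ γ, Fin (u γ).size =>
      .pair (e x.1) (.pair (encNat (u x.1 / 2 ^ (x.2 : ℕ))) (a x.1 x.2)))
      fun x => a x.1 (x.2 + 1)) : PolyTime e fun γ => a γ (u γ).size := by
  -- The halved number is the guard: it becomes zero after exactly `(u γ).size` halvings.
  let s : Γ → ℕ → Val := fun γ i => .pair (encNat (u γ / 2 ^ i)) (.pair (e γ) (a γ i))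
  have hs : PolyTime e fun γ => s γ (u γ).size := by
    refine loop ?_ ?_ ?_ ?_ ?_ ?_
    · exact (hu.pair ((refl e).pair h₀)).congr fun γ => by simp [s]
    · intro γ i hi
      have h1 : 2 ^ i ≤ u γ := Nat.lt_size.1 hi
      have h2 : u γ / 2 ^ i ≠ 0 := (Nat.div_pos h1 (by positivity)).ne'
      simp only [s, fst_pair, encNat, ne_eq, int.injEq]
      exact_mod_cast h2
    · intro γ
      simp only [s, fst_pair, encNat, int.injEq]
      exact_mod_cast Nat.div_eq_of_lt (Nat.lt_size_self _)
    · exact hu.sizeBdd.mono fun γ => by simp [encNat]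
    · refine ((((hu.sizeBdd.comap Sigma.fst).add (.refl _)).add ha).add (.const _ 2)).mono
        fun x => ?_
      have h1 : (encNat (u x.1 / 2 ^ (x.2 : ℕ))).size ≤ (encNat (u x.1)).size := by
        have := Nat.size_le_size (Nat.div_le_self (u x.1) (2 ^ (x.2 : ℕ)))
        simpa only [encNat, size_int, Int.natAbs_natCast, add_le_add_iff_left] using this
      simp only [s, size_pair]
      omega
    · have h := refl fun x : Σ γ, Fin (u γ).size => s x.1 x.2
      refine (((h.left.div (const _ 2)).congr fun x => ?_).pair
        (h.right.left.pair ((h.right.left.pair (h.left.pair h.right.right)).trans hstep)))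
      simp only [encNat, pow_succ, ← Nat.div_div_eq_div_mul]
      push_cast
      rfl
  exact hs.right.right

end PolyTime

end While

/-! ### Minimum-cost circulations by capacity scaling -/

/-- A directed graph with integral edge costs. -/
structure Network where
  n : ℕ
  m : ℕ
  tail : Fin m → Fin n
  head : Fin m → Fin n
  cost : Fin m → ℤ

namespace Network

variable (N : Network)

/-- The outflow minus the inflow at a vertex. -/
def div {R : Type} [Ring R] (f : Fin N.m → R) (v : Fin N.n) : R :=
  ∑ e, f e * ((if N.tail e = v then 1 else 0) - (if N.head e = v then 1 else 0))

/-- Summation by parts. For a circulation the left side vanishes, so potentials change the cost of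
edges but not the cost of a circulation. -/
theorem sum_pot_mul_div {R : Type} [CommRing R] (f : Fin N.m → R) (π : Fin N.n → R) :
    ∑ v, π v * N.div f v = ∑ e, f e * (π (N.tail e) - π (N.head e)) := by
  simp only [div, Finset.mul_sum]
  rw [Finset.sum_comm]
  refine Finset.sum_congr rfl fun e _ => ?_
  have h : ∀ u, ∑ v, π v * (if u = v then (1 : R) else 0) = π u := fun u => by simp
  calc ∑ v, π v * (f e * ((if N.tail e = v then 1 else 0) - (if N.head e = v then 1 else 0)))
      = f e * (∑ v, π v * (if N.tail e = v then 1 else 0) -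
          ∑ v, π v * (if N.head e = v then 1 else 0)) := by
        rw [← Finset.sum_sub_distrib, Finset.mul_sum]
        exact Finset.sum_congr rfl fun v _ => by ring
    _ = _ := by rw [h, h]

theorem div_add_single {R : Type} [Ring R] (f : Fin N.m → R) (e : Fin N.m) (a : R) (v : Fin N.n) :
    N.div (fun e' => f e' + if e' = e then a else 0) v =
      N.div f v + a * ((if N.tail e = v then 1 else 0) - (if N.head e = v then 1 else 0)) := by
  simp only [div, add_mul, Finset.sum_add_distrib, ite_mul, zero_mul, Finset.sum_ite_eq',
    Finset.mem_univ, if_true]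

/-- The reduced cost of an edge with respect to vertex potentials. -/
def redCost (π : Fin N.n → ℤ) (e : Fin N.m) : ℤ := N.cost e + π (N.tail e) - π (N.head e)

/-- `f` respects the capacities and satisfies complementary slackness with the potentials `π`. -/
def Opt (cap f : Fin N.m → ℤ) (π : Fin N.n → ℤ) : Prop :=
  ∀ e, 0 ≤ f e ∧ f e ≤ cap e ∧ (0 < N.redCost π e → f e = 0) ∧ (N.redCost π e < 0 → f e = cap e)

/-- Complementary slackness certifies that a circulation has minimum cost. -/
theorem Opt.cost_le {N : Network} {cap f : Fin N.m → ℤ} {π : Fin N.n → ℤ} (h : N.Opt cap f π)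
    (hf : ∀ v, N.div f v = 0) {g : Fin N.m → ℝ} (hg : ∀ e, 0 ≤ g e ∧ g e ≤ cap e)
    (hdiv : ∀ v, N.div g v = 0) :
    ∑ e, (f e : ℝ) * (N.cost e : ℝ) ≤ ∑ e, g e * (N.cost e : ℝ) := by
  have h1 : ∑ e, (f e : ℝ) * ((π (N.tail e) : ℝ) - π (N.head e)) = 0 := by
    have := N.sum_pot_mul_div f π
    simp only [hf, mul_zero, Finset.sum_const_zero] at this
    exact_mod_cast this.symm
  have h2 : ∑ e, g e * ((π (N.tail e) : ℝ) - π (N.head e)) = 0 := by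
    have := N.sum_pot_mul_div g fun v => (π v : ℝ)
    simp only [hdiv, mul_zero, Finset.sum_const_zero] at this
    exact this.symm
  -- The comparison holds edge by edge: `f` is full where the reduced cost is negative and empty
  -- where it is positive.
  have h3 : ∑ e, (f e : ℝ) * (N.redCost π e : ℝ) ≤ ∑ e, g e * (N.redCost π e : ℝ) := by
    refine Finset.sum_le_sum fun e _ => ?_
    obtain ⟨-, -, h5, h6⟩ := h e
    rcases lt_trichotomy (N.redCost π e) 0 with hr | hr | hr
    · rw [h6 hr]
      exact mul_le_mul_of_nonpos_right (hg e).2 (by exact_mod_cast hr.le)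
    · simp [hr]
    · rw [h5 hr]
      simpa using mul_nonneg (hg e).1 (by exact_mod_cast hr.le)
  have h4 : ∀ x : Fin N.m → ℝ, ∑ e, x e * (N.redCost π e : ℝ) =
      ∑ e, x e * (N.cost e : ℝ) + ∑ e, x e * ((π (N.tail e) : ℝ) - π (N.head e)) := fun x => by
    rw [← Finset.sum_add_distrib]
    refine Finset.sum_congr rfl fun e _ => ?_
    simp only [redCost]
    push_cast
    ring
  rw [h4, h4, h1, h2] at h3
  linarith

/-! ### Primal-dual search for an augmenting path. -/

/-- The state of the search for an augmenting path: potentials, the set of vertices that have been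
reached, and for each of these the flow after one unit has been sent to it. -/
structure Search where
  pot : Fin N.n → ℤ
  mem : Fin N.n → Bool
  aug : Fin N.n → Fin N.m → ℤ

section Search

variable {N} (cap f : Fin N.m → ℤ) (e₀ : Fin N.m) (S : N.Search)

/-- The edge `e` leaves the reached set in the residual graph; `e₀` is always traversable
backwards. -/
def leaves (e : Fin N.m) : Bool :=
  if S.mem (N.tail e) then !S.mem (N.head e) && decide (f e < cap e)
  else S.mem (N.head e) && (decide (0 < f e) || decide (e = e₀))

/-- The reduced cost of an edge in the direction in which it leaves the reached set. -/
def slack (e : Fin N.m) : ℤ :=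
  if S.mem (N.tail e) then N.redCost S.pot e else -N.redCost S.pot e

/-- An edge of minimum slack that leaves the reached set. -/
def choice : Option (Fin N.m) :=
  (List.finRange N.m).find? fun e => leaves cap f e₀ S e &&
    !(List.finRange N.m).any fun e' => leaves cap f e₀ S e' && decide (slack S e' < slack S e)

/-- The reached set grows along the edge `e`. -/
def advance (e : Fin N.m) : N.Search where
  pot v := if S.mem v then S.pot v else S.pot v + slack S e
  mem v := S.mem v || (decide (v = N.tail e) || decide (v = N.head e))
  aug v e' := if S.mem v then S.aug v e' else
    if S.mem (N.tail e) then S.aug (N.tail e) e' + (if e' = e then 1 else 0)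
    else S.aug (N.head e) e' + (if e' = e then -1 else 0)

/-- The search is over: the tail of `e₀` is reached, or `e₀` has nonnegative reduced cost. -/
def finished : Bool := S.mem (N.tail e₀) || decide (0 ≤ N.redCost S.pot e₀)

def searchStep : N.Search :=
  if finished e₀ S then S else
    match choice cap f e₀ S with
    | none => S
    | some e => advance S e

/-- The search starts at the head of `e₀`. -/
def searchStart (π : Fin N.n → ℤ) : N.Search where
  pot := π
  mem v := decide (v = N.head e₀)
  aug _ := f

def search (π : Fin N.n → ℤ) (i : ℕ) : N.Search := (searchStep cap f e₀)^[i] (searchStart f e₀ π)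

/-- The invariant of the search. -/
structure SearchInv : Prop where
  opt : N.Opt cap f S.pot
  mem_head : N.redCost S.pot e₀ < 0 → S.mem (N.head e₀) = true
  aug_opt : N.redCost S.pot e₀ < 0 → ∀ v, S.mem v = true → N.Opt cap (S.aug v) S.pot
  aug_eq : N.redCost S.pot e₀ < 0 → ∀ v, S.mem v = true → ∀ e,
    (S.mem (N.tail e) = false ∨ S.mem (N.head e) = false) → S.aug v e = f e
  aug_div : N.redCost S.pot e₀ < 0 → ∀ v, S.mem v = true → ∀ w, N.div (S.aug v) w =
    (if N.head e₀ = w then 1 else 0) - (if v = w then 1 else 0)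

variable {cap f e₀ S}

theorem choice_spec {e : Fin N.m} (h : choice cap f e₀ S = some e) :
    leaves cap f e₀ S e = true ∧ ∀ e', leaves cap f e₀ S e' = true → slack S e ≤ slack S e' := by
  have h1 := List.find?_some h
  simp only [Bool.and_eq_true, Bool.not_eq_true', List.any_eq_false, List.mem_finRange,
    decide_eq_true_eq, not_and, not_lt, forall_const] at h1
  exact h1

theorem choice_ne_none (h : ∃ e, leaves cap f e₀ S e = true) : choice cap f e₀ S ≠ none := by
  obtain ⟨e, he, hmin⟩ := Finset.exists_min_image
    (Finset.univ.filter fun e => leaves cap f e₀ S e = true) (slack S) (by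
      obtain ⟨e, he⟩ := h
      exact ⟨e, by simpa using he⟩)
  simp only [Finset.mem_filter, Finset.mem_univ, true_and] at he hmin
  intro hn
  rw [choice, List.find?_eq_none] at hn
  have := hn e (List.mem_finRange e)
  simp only [he, Bool.true_and, Bool.not_eq_true, Bool.not_eq_false', List.any_eq_true,
    List.mem_finRange, true_and, Bool.and_eq_true, decide_eq_true_eq] at this
  obtain ⟨e', h1, h2⟩ := this
  exact absurd (hmin e' h1) (not_le.2 h2)

theorem SearchInv.start {π : Fin N.n → ℤ} (h : N.Opt cap f π) (hf : ∀ v, N.div f v = 0) :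
    SearchInv cap f e₀ (searchStart f e₀ π) where
  opt := h
  mem_head _ := by simp [searchStart]
  aug_opt _ _ _ := h
  aug_eq _ _ _ _ _ := rfl
  aug_div _ v hv w := by
    simp only [searchStart, decide_eq_true_eq] at hv ⊢
    rw [hf, hv, sub_self]

/-- Complementary slackness gives residual edges the right sign. The edge `e₀` may be used backwards
without carrying flow, and there the sign comes from `hr`. -/
theorem slack_nonneg (h : SearchInv cap f e₀ S) (hr : N.redCost S.pot e₀ < 0) {e : Fin N.m}
    (he : leaves cap f e₀ S e = true) : 0 ≤ slack S e := by
  obtain ⟨h1, h2, h3, h4⟩ := h.opt e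
  unfold leaves at he
  unfold slack
  split_ifs at he ⊢
  · simp only [Bool.and_eq_true, decide_eq_true_eq] at he
    by_contra hlt
    have := h4 (by omega)
    omega
  · simp only [Bool.and_eq_true, Bool.or_eq_true, decide_eq_true_eq] at he
    rcases he.2 with he | rfl
    · by_contra hlt
      have := h3 (by omega)
      omega
    · omega

theorem redCost_advance (e e' : Fin N.m) : N.redCost (advance S e).pot e' =
    N.redCost S.pot e' + (if S.mem (N.tail e') then 0 else slack S e) -
      (if S.mem (N.head e') then 0 else slack S e) := by
  simp only [redCost, advance]
  split_ifs <;> ring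

theorem leaves_mem {e : Fin N.m} (he : leaves cap f e₀ S e = true) :
    (S.mem (N.tail e) = true ∧ S.mem (N.head e) = false) ∨
      (S.mem (N.tail e) = false ∧ S.mem (N.head e) = true) := by
  unfold leaves at he
  cases h1 : S.mem (N.tail e) <;> cases h2 : S.mem (N.head e) <;> simp_all

theorem redCost_advance_self {e : Fin N.m} (he : leaves cap f e₀ S e = true) :
    N.redCost (advance S e).pot e = 0 := by
  rw [redCost_advance]
  rcases leaves_mem he with h | h <;> simp [h, slack]

/-- Raising the unreached potentials by the minimum slack makes `e` tight and keeps slackness on all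
other edges. The augmented flows agree with `f` on every edge with an unreached endpoint, so a
residual test against `f` is also valid for them. Once `e₀` itself is used, its reduced cost becomes
0 and the augmented flows are no longer needed; this is why the invariant claims them only for
negative reduced cost. -/
theorem SearchInv.advance {e : Fin N.m} (h : SearchInv cap f e₀ S)
    (hr : N.redCost S.pot e₀ < 0) (he : leaves cap f e₀ S e = true)
    (hmin : ∀ e', leaves cap f e₀ S e' = true → slack S e ≤ slack S e') :
    SearchInv cap f e₀ (Network.advance S e) := by
  have hδ := slack_nonneg h hr he
  have hself := redCost_advance_self he
  -- Only edges with exactly one reached endpoint change their reduced cost. If one of them is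
  -- residual in the direction out of the reached set, minimality of the slack keeps its sign;
  -- otherwise slackness in that direction holds by saturation or emptiness.
  have hopt : N.Opt cap f (Network.advance S e).pot := by
    intro e'
    obtain ⟨h1, h2, h3, h4⟩ := h.opt e'
    rw [redCost_advance]
    have h5 := hmin e'
    unfold leaves at h5
    generalize slack S e = δ at hδ h5
    unfold slack at h5
    refine ⟨h1, h2, ?_, ?_⟩ <;>
      cases ht : S.mem (N.tail e') <;> cases hh : S.mem (N.head e') <;>
        simp only [ht, hh, if_true, if_false, Bool.false_eq_true, Bool.not_true, Bool.not_false,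
          Bool.true_and, Bool.false_and, decide_eq_true_eq, Bool.or_eq_true] at h5 ⊢ <;> intro h6
    · exact h3 (by omega)
    · by_contra h7
      have := h5 (Or.inl (by omega))
      omega
    · exact h3 (by omega)
    · exact h3 (by omega)
    · exact h4 (by omega)
    · exact h4 (by omega)
    · by_contra h7
      have := h5 (by omega)
      omega
    · exact h4 (by omega)
  have hold : N.redCost (Network.advance S e).pot e₀ < 0 → ∀ v, S.mem v = true →
      N.Opt cap (S.aug v) (Network.advance S e).pot := by
    intro _ v hv e'
    -- Inside the reached set reduced costs do not change; on all other edges the augmented flow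
    -- equals `f`.
    by_cases hin : S.mem (N.tail e') = true ∧ S.mem (N.head e') = true
    · have := h.aug_opt hr v hv e'
      rw [redCost_advance]
      simpa [hin] using this
    · rw [h.aug_eq hr v hv e' (by
        simp only [← Bool.not_eq_true]; tauto)]
      exact hopt e'
  -- Both directions at once: `x` is the reached endpoint of `e`, `y` the new one, and `s` is the
  -- sign of the unit pushed from `x` to `y`.
  obtain ⟨x, y, s, hx, hy, hmem, hxy, haug, hs, hdiv⟩ : ∃ (x y : Fin N.n) (s : ℤ),
      S.mem x = true ∧ S.mem y = false ∧
      (∀ v, (Network.advance S e).mem v = true ↔ S.mem v = true ∨ v = y) ∧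
      (N.tail e = x ∧ N.head e = y ∨ N.tail e = y ∧ N.head e = x) ∧
      ((Network.advance S e).aug y = fun e' => S.aug x e' + if e' = e then s else 0) ∧
      (e ≠ e₀ → 0 ≤ f e + s ∧ f e + s ≤ cap e) ∧
      ∀ w, s * ((if N.tail e = w then 1 else 0) - (if N.head e = w then 1 else 0)) =
        (if x = w then 1 else 0) - (if y = w then 1 else 0) := by
    have h1 := (h.opt e).1
    have h2 := (h.opt e).2.1
    rcases leaves_mem he with ⟨ht, hh⟩ | ⟨ht, hh⟩
    · refine ⟨N.tail e, N.head e, 1, ht, hh, fun v => ?_, Or.inl ⟨rfl, rfl⟩, ?_, fun _ => ?_,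
        fun w => by ring⟩
      · simp only [Network.advance, Bool.or_eq_true, decide_eq_true_eq]
        constructor
        · rintro (h | rfl | h) <;> simp_all
        · tauto
      · funext e'
        simp [Network.advance, ht, hh]
      · simp only [leaves, ht, hh, if_true, Bool.not_false, Bool.true_and, decide_eq_true_eq] at he
        omega
    · refine ⟨N.head e, N.tail e, -1, hh, ht, fun v => ?_, Or.inr ⟨rfl, rfl⟩, ?_, fun hne => ?_,
        fun w => by ring⟩
      · simp only [Network.advance, Bool.or_eq_true, decide_eq_true_eq]
        constructor
        · rintro (h | h | rfl) <;> simp_all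
        · tauto
      · funext e'
        simp [Network.advance, ht]
      · simp only [leaves, ht, hh, Bool.false_eq_true, if_false, Bool.true_and, Bool.or_eq_true,
          decide_eq_true_eq, hne, or_false] at he
        omega
  have haug_old : ∀ v, S.mem v = true → (Network.advance S e).aug v = S.aug v := fun v hv => by
    funext e'
    simp [Network.advance, hv]
  have hmem_false : ∀ v, (Network.advance S e).mem v = false → S.mem v = false := fun v hv => by
    by_contra hc
    rw [Bool.not_eq_false] at hc
    rw [(hmem v).2 (Or.inl hc)] at hv
    cases hv
  have hxe : S.aug x e = f e := h.aug_eq hr x hx e (by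
    rcases hxy with ⟨-, h2⟩ | ⟨h1, -⟩
    · exact Or.inr (h2 ▸ hy)
    · exact Or.inl (h1 ▸ hy))
  refine ⟨hopt, fun _ => (hmem _).2 (Or.inl (h.mem_head hr)), fun hr' v hv => ?_,
    fun hr' v hv e' he' => ?_, fun hr' v hv w => ?_⟩
  · rcases (hmem v).1 hv with hv | rfl
    · rw [haug_old v hv]
      exact hold hr' v hv
    · rw [haug]
      intro e'
      obtain ⟨h1, h2, h3, h4⟩ := hold hr' x hx e'
      by_cases hee : e' = e
      · subst hee
        -- The edge just used has reduced cost 0, whereas that of `e₀` is still negative.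
        have hne : e' ≠ e₀ := by
          rintro rfl
          omega
        simp only [if_true, hxe, hself, lt_irrefl, false_imp_iff, and_true]
        exact hs hne
      · simpa only [hee, if_false, add_zero] using ⟨h1, h2, h3, h4⟩
  · have he'' : S.mem (N.tail e') = false ∨ S.mem (N.head e') = false :=
      he'.imp (hmem_false _) (hmem_false _)
    rcases (hmem v).1 hv with hv | rfl
    · rw [haug_old v hv]
      exact h.aug_eq hr v hv e' he''
    · have hee : e' ≠ e := by
        rintro rfl
        have h1 := (hmem x).2 (Or.inl hx)
        rcases hxy with ⟨h2, h3⟩ | ⟨h2, h3⟩ <;> rw [h2, h3] at he' <;> simp [h1, hv] at he'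
      rw [haug]
      simp only [hee, if_false, add_zero]
      exact h.aug_eq hr x hx e' he''
  · rcases (hmem v).1 hv with hv | rfl
    · rw [haug_old v hv]
      exact h.aug_div hr v hv w
    · rw [haug, div_add_single, h.aug_div hr x hx w, hdiv]
      ring

theorem SearchInv.step (h : SearchInv cap f e₀ S) : SearchInv cap f e₀ (searchStep cap f e₀ S) := by
  unfold searchStep
  split_ifs with hfin
  · exact h
  · simp only [finished, Bool.or_eq_true, decide_eq_true_eq, not_or, not_le] at hfin
    split
    · exact h
    · rename_i e hc
      obtain ⟨h1, h2⟩ := choice_spec hc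
      exact h.advance hfin.2 h1 h2

theorem SearchInv.search {π : Fin N.n → ℤ} (h : N.Opt cap f π) (hf : ∀ v, N.div f v = 0) (i : ℕ) :
    SearchInv cap f e₀ (Network.search cap f e₀ π i) := by
  induction i with
  | zero => exact .start h hf
  | succ i ih =>
    rw [Network.search, Function.iterate_succ_apply']
    exact ih.step

theorem card_lt_card_advance {e : Fin N.m} (he : leaves cap f e₀ S e = true) :
    (Finset.univ.filter fun v => S.mem v = true).card <
      (Finset.univ.filter fun v => (advance S e).mem v = true).card := by
  refine Finset.card_lt_card (Finset.ssubset_iff_of_subset (fun v hv => ?_) |>.2 ?_)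
  · simp only [Finset.mem_filter, Finset.mem_univ, true_and] at hv ⊢
    simp [advance, hv]
  · rcases leaves_mem he with h | h
    · exact ⟨N.head e, by simp [advance], by simp [h]⟩
    · exact ⟨N.tail e, by simp [advance], by simp [h]⟩

/-- As long as the search is not over, it reaches a new vertex in each step. -/
theorem finished_or_card {π : Fin N.n → ℤ} (h : N.Opt cap f π) (hf : ∀ v, N.div f v = 0) (i : ℕ) :
    finished e₀ (search cap f e₀ π i) = true ∨
      i + 1 ≤ (Finset.univ.filter fun v => (search cap f e₀ π i).mem v = true).card := by
  induction i with
  | zero =>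
    right
    refine Finset.card_pos.2 ⟨N.head e₀, ?_⟩
    simp [search, searchStart]
  | succ i ih =>
    have hinv := SearchInv.search (e₀ := e₀) h hf i
    rw [search, Function.iterate_succ_apply', ← search]
    generalize search cap f e₀ π i = S at ih hinv
    by_cases hfin : finished e₀ S = true
    · left
      rwa [searchStep, if_pos hfin]
    · right
      have hcard := ih.resolve_left hfin
      rw [searchStep, if_neg hfin]
      simp only [finished, Bool.or_eq_true, decide_eq_true_eq, not_or, not_le,
        Bool.not_eq_true] at hfin
      split
      · rename_i hc
        -- The search cannot get stuck: while it is unfinished, `e₀` traversed backwards leaves the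
        -- reached set.
        refine absurd hc (choice_ne_none ⟨e₀, ?_⟩)
        simp [leaves, hfin.1, hinv.mem_head hfin.2]
      · rename_i e hc
        have := card_lt_card_advance (choice_spec hc).1
        omega

/-- The search starts with one reached vertex, so being unfinished after `n` steps would require `n
+ 1` vertices. -/
theorem finished_search {π : Fin N.n → ℤ} (h : N.Opt cap f π) (hf : ∀ v, N.div f v = 0) :
    finished e₀ (search cap f e₀ π N.n) = true := by
  refine (finished_or_card h hf N.n).resolve_right fun hc => ?_
  have := Finset.card_le_univ (Finset.univ.filter fun v => (search cap f e₀ π N.n).mem v = true)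
  rw [Fintype.card_fin] at this
  omega

end Search

/-! ### Raising capacities by units and scaling. -/

/-- Capacities, a flow, and potentials. -/
structure FlowState where
  cap : Fin N.m → ℤ
  flow : Fin N.m → ℤ
  pot : Fin N.n → ℤ

namespace FlowState

variable {N}

/-- The flow is a minimum-cost circulation, as certified by the potentials. -/
def Valid (T : N.FlowState) : Prop := N.Opt T.cap T.flow T.pot ∧ ∀ v, N.div T.flow v = 0

def zero : N.FlowState := ⟨fun _ => 0, fun _ => 0, fun _ => 0⟩

theorem zero_valid : (zero : N.FlowState).Valid :=
  ⟨fun e => by simp [zero], fun v => by simp [zero, div]⟩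

/-- Increase the capacity of `e₀` by one and restore optimality. -/
def bump (T : N.FlowState) (e₀ : Fin N.m) : N.FlowState where
  cap e := T.cap e + if e = e₀ then 1 else 0
  flow e := if 0 ≤ N.redCost (search T.cap T.flow e₀ T.pot N.n).pot e₀ then T.flow e
    else (search T.cap T.flow e₀ T.pot N.n).aug (N.tail e₀) e + if e = e₀ then 1 else 0
  pot := (search T.cap T.flow e₀ T.pot N.n).pot

/-- If the reduced cost of `e₀` has become nonnegative, the new unit of capacity may stay empty.
Otherwise the tail of `e₀` is reached, and the unit sent there from its head returns through `e₀`.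
Slackness makes the augmented flow full on `e₀` before this, so it is full again for the raised
capacity. -/
theorem bump_valid {T : N.FlowState} (h : T.Valid) (e₀ : Fin N.m) : (T.bump e₀).Valid := by
  have hinv := SearchInv.search (e₀ := e₀) h.1 h.2 N.n
  have hfin := finished_search (e₀ := e₀) h.1 h.2
  unfold bump Valid
  generalize search T.cap T.flow e₀ T.pot N.n = S at hinv hfin
  simp only [finished, Bool.or_eq_true, decide_eq_true_eq] at hfin
  by_cases hr : 0 ≤ N.redCost S.pot e₀
  · simp only [hr, if_true]
    refine ⟨fun e => ?_, h.2⟩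
    obtain ⟨h1, h2, h3, h4⟩ := hinv.opt e
    by_cases he : e = e₀
    · subst he
      simp only [if_true]
      exact ⟨h1, by omega, h3, fun h5 => absurd hr (not_le.2 h5)⟩
    · simpa only [he, if_false, add_zero] using ⟨h1, h2, h3, h4⟩
  · have hmem := hfin.resolve_right hr
    simp only [hr, if_false]
    rw [not_le] at hr
    refine ⟨fun e => ?_, fun v => ?_⟩
    · obtain ⟨h1, h2, h3, h4⟩ := hinv.aug_opt hr _ hmem e
      by_cases he : e = e₀
      · subst he
        have := h4 hr
        simp only [if_true]
        exact ⟨by omega, by omega, fun h5 => by omega, fun _ => by omega⟩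
      · simpa only [he, if_false, add_zero] using ⟨h1, h2, h3, h4⟩
    · rw [div_add_single, hinv.aug_div hr _ hmem]
      ring

def double (T : N.FlowState) : N.FlowState := ⟨fun e => 2 * T.cap e, fun e => 2 * T.flow e, T.pot⟩

/-- All conditions are homogeneous in capacities and flow together; the potentials need no change.
-/
theorem double_valid {T : N.FlowState} (h : T.Valid) : T.double.Valid := by
  refine ⟨fun e => ?_, fun v => ?_⟩
  · obtain ⟨h1, h2, h3, h4⟩ := h.1 e
    simp only [double]
    exact ⟨by omega, by omega, fun h5 => by have := h3 h5; omega, fun h5 => by have := h4 h5; omega⟩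
  · have := h.2 v
    simp only [div, double, mul_assoc, ← Finset.mul_sum] at this ⊢
    rw [this, mul_zero]

/-- Increase the capacities that are below `c` by one, for the first `i` edges. -/
def raise (c : Fin N.m → ℤ) (T : N.FlowState) : ℕ → N.FlowState
  | 0 => T
  | i + 1 => if h : i < N.m then
      if (raise c T i).cap ⟨i, h⟩ < c ⟨i, h⟩ then (raise c T i).bump ⟨i, h⟩ else raise c T i
    else raise c T i

theorem raise_valid {c : Fin N.m → ℤ} {T : N.FlowState} (h : T.Valid) (i : ℕ) :
    (raise c T i).Valid := by
  induction i with
  | zero => exact h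
  | succ i ih =>
    rw [raise]
    split_ifs
    · exact bump_valid ih _
    · exact ih
    · exact ih

/-- Every capacity misses its goal by at most one, so one pass with at most one unit per edge
suffices. -/
theorem raise_cap {c : Fin N.m → ℤ} {T : N.FlowState} (h : ∀ e, T.cap e ≤ c e ∧ c e ≤ T.cap e + 1)
    (i : ℕ) (e : Fin N.m) : (raise c T i).cap e = if (e : ℕ) < i then c e else T.cap e := by
  induction i with
  | zero => simp [raise]
  | succ i ih =>
    have h1 := h e
    rw [raise]
    split_ifs with hi hlt he he he
    · simp only [bump, ih]
      by_cases hei : e = ⟨i, hi⟩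
      · subst hei
        simp only [ih, lt_irrefl, if_false] at hlt
        simp
        omega
      · have : (e : ℕ) ≠ i := fun h' => hei (Fin.ext h')
        simp only [hei, if_false, add_zero]
        rw [if_pos (by omega)]
    · simp only [bump, ih]
      rw [if_neg (by omega), if_neg (by rintro rfl; simp at he)]
      ring
    · by_cases hei : e = ⟨i, hi⟩
      · subst hei
        simp only [ih, lt_irrefl, if_false] at hlt ⊢
        omega
      · have : (e : ℕ) ≠ i := fun h' => hei (Fin.ext h')
        rw [ih, if_pos (by omega)]
    · rw [ih, if_neg (by omega)]
    · have := e.2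
      rw [ih, if_pos (by omega)]
    · have := e.2
      omega

/-- One scaling phase: pass to the capacities `c / p`. -/
def phase (c : Fin N.m → ℤ) (p : ℤ) (T : N.FlowState) : N.FlowState :=
  raise (fun e => c e / p) T.double N.m

/-- The state after the first `i` scaling phases, with `p = P, P / 2, P / 4, …`. -/
def scaling (c : Fin N.m → ℤ) (P : ℕ) : ℕ → N.FlowState
  | 0 => zero
  | i + 1 => phase c ((P / 2 ^ i : ℕ) : ℤ) (scaling c P i)

theorem scaling_valid (c : Fin N.m → ℤ) (P : ℕ) (i : ℕ) : (scaling c P i).Valid := by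
  induction i with
  | zero => exact zero_valid
  | succ i ih => exact raise_valid (double_valid ih) _

/-- The number `c e / 2 ^ j` is twice `c e / 2 ^ (j + 1)` or one more, which is the situation of
`raise_cap` after doubling. Starting from zero is right since `c e < 2 ^ L`. -/
theorem scaling_cap {c : Fin N.m → ℤ} {L : ℕ} (hc : ∀ e, 0 ≤ c e ∧ c e < 2 ^ L) {i : ℕ}
    (hi : i ≤ L + 1) (e : Fin N.m) : (scaling c (2 ^ L) i).cap e = c e / 2 ^ (L + 1 - i) := by
  induction i generalizing e with
  | zero =>
    have h1 := hc e
    rw [Int.ediv_eq_zero_of_lt h1.1]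
    · rfl
    · rw [Nat.sub_zero, pow_succ]
      omega
  | succ i ih =>
    have hp : ((2 ^ L / 2 ^ i : ℕ) : ℤ) = 2 ^ (L - i) := by
      rw [Nat.pow_div (by omega) (by norm_num)]
      push_cast
      rfl
    have hL : L + 1 - (i + 1) = L - i := by omega
    rw [scaling, phase, raise_cap, if_pos e.2, hp, hL]
    intro e
    have h1 : c e / 2 ^ (L + 1 - i) = c e / 2 ^ (L - i) / 2 := by
      rw [show L + 1 - i = L - i + 1 by omega, pow_succ, Int.ediv_ediv_of_nonneg (by positivity)]
    simp only [double, ih (by omega), h1, hp]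
    omega

theorem scaling_cap_eq {c : Fin N.m → ℤ} {L : ℕ} (hc : ∀ e, 0 ≤ c e ∧ c e < 2 ^ L) (e : Fin N.m) :
    (scaling c (2 ^ L) (L + 1)).cap e = c e := by
  simpa using scaling_cap hc le_rfl e

end FlowState

/-! #### Growth of the numbers -/

section Growth

variable {N}

theorem abs_redCost_le {π : Fin N.n → ℤ} {B : ℕ} (hc : ∀ e, |N.cost e| ≤ 2 ^ B)
    (hπ : ∀ v, |π v| ≤ 2 ^ B) (e : Fin N.m) : |N.redCost π e| ≤ 3 * 2 ^ B := by
  have h1 := abs_le.1 (hc e)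
  have h2 := abs_le.1 (hπ (N.tail e))
  have h3 := abs_le.1 (hπ (N.head e))
  rw [redCost, abs_le]
  constructor <;> linarith

/-- All numbers of the search state are at most `2 ^ B`. -/
def Search.Bdd (S : N.Search) (B : ℕ) : Prop :=
  (∀ v, |S.pot v| ≤ 2 ^ B) ∧ ∀ v e, |S.aug v e| ≤ 2 ^ B

theorem Search.Bdd.mono {S : N.Search} {B C : ℕ} (h : S.Bdd B) (hBC : B ≤ C) : S.Bdd C :=
  have h1 : (2 : ℤ) ^ B ≤ 2 ^ C := pow_le_pow_right₀ (by norm_num) hBC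
  ⟨fun v => (h.1 v).trans h1, fun v e => (h.2 v e).trans h1⟩

/-- A slack combines one cost and two potentials, hence is at most `3 * 2 ^ B`; added to a potential
it gives `4 * 2 ^ B`, two more bits. -/
theorem Search.Bdd.advance {S : N.Search} {B : ℕ} (hc : ∀ e, |N.cost e| ≤ 2 ^ B) (h : S.Bdd B)
    (e : Fin N.m) : (Network.advance S e).Bdd (B + 2) := by
  have hpow : (2 : ℤ) ^ (B + 2) = 4 * 2 ^ B := by ring
  have hone : (1 : ℤ) ≤ 2 ^ B := one_le_pow₀ (by norm_num)
  have hs : |slack S e| ≤ 3 * 2 ^ B := by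
    unfold slack
    split_ifs
    · exact abs_redCost_le hc h.1 e
    · rw [abs_neg]
      exact abs_redCost_le hc h.1 e
  refine ⟨fun v => ?_, fun v e' => ?_⟩
  · have h1 := abs_le.1 (h.1 v)
    have h2 := abs_le.1 hs
    simp only [Network.advance]
    rw [hpow, abs_le]
    split_ifs <;> constructor <;> linarith
  · have h1 := abs_le.1 (h.2 v e')
    have h2 := abs_le.1 (h.2 (N.tail e) e')
    have h3 := abs_le.1 (h.2 (N.head e) e')
    simp only [Network.advance]
    rw [hpow, abs_le]
    split_ifs <;> constructor <;> linarith

theorem search_bdd {cap f : Fin N.m → ℤ} {e₀ : Fin N.m} {π : Fin N.n → ℤ} {B : ℕ}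
    (hc : ∀ e, |N.cost e| ≤ 2 ^ B) (hf : ∀ e, |f e| ≤ 2 ^ B) (hπ : ∀ v, |π v| ≤ 2 ^ B) (i : ℕ) :
    (search cap f e₀ π i).Bdd (B + 2 * i) := by
  induction i with
  | zero => exact ⟨hπ, fun _ => hf⟩
  | succ i ih =>
    rw [search, Function.iterate_succ_apply', ← search, searchStep]
    split_ifs
    · exact ih.mono (by omega)
    · split
      · exact ih.mono (by omega)
      · exact ih.advance (fun e => (hc e).trans (pow_le_pow_right₀ (by norm_num) (by omega))) _

namespace FlowState

/-- All numbers of the state are at most `2 ^ B`. -/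
def Bdd (T : N.FlowState) (B : ℕ) : Prop :=
  (∀ e, |T.cap e| ≤ 2 ^ B) ∧ (∀ e, |T.flow e| ≤ 2 ^ B) ∧ ∀ v, |T.pot v| ≤ 2 ^ B

theorem Bdd.mono {T : N.FlowState} {B C : ℕ} (h : T.Bdd B) (hBC : B ≤ C) : T.Bdd C :=
  have h1 : (2 : ℤ) ^ B ≤ 2 ^ C := pow_le_pow_right₀ (by norm_num) hBC
  ⟨fun e => (h.1 e).trans h1, fun e => (h.2.1 e).trans h1, fun v => (h.2.2 v).trans h1⟩

theorem zero_bdd (B : ℕ) : (zero : N.FlowState).Bdd B := by simp [zero, Bdd]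

theorem Bdd.bump {T : N.FlowState} {B : ℕ} (hc : ∀ e, |N.cost e| ≤ 2 ^ B) (h : T.Bdd B)
    (e₀ : Fin N.m) : (T.bump e₀).Bdd (B + 2 * (N.n + 1)) := by
  have hS := search_bdd (cap := T.cap) (e₀ := e₀) hc h.2.1 h.2.2 N.n
  have hB : (2 : ℤ) ^ B ≤ 2 ^ (B + 2 * N.n) := pow_le_pow_right₀ (by norm_num) (by omega)
  have hone : (1 : ℤ) ≤ 2 ^ (B + 2 * N.n) := one_le_pow₀ (by norm_num)
  have hpow : (2 : ℤ) ^ (B + 2 * (N.n + 1)) = 4 * 2 ^ (B + 2 * N.n) := by ring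
  refine ⟨fun e => ?_, fun e => ?_, fun v => ?_⟩
  · have h1 := abs_le.1 (h.1 e)
    simp only [FlowState.bump]
    rw [hpow, abs_le]
    split_ifs <;> constructor <;> linarith
  · have h1 := abs_le.1 (h.2.1 e)
    have h2 := abs_le.1 (hS.2 (N.tail e₀) e)
    simp only [FlowState.bump]
    rw [hpow, abs_le]
    split_ifs <;> constructor <;> linarith
  · have h1 := abs_le.1 (hS.1 v)
    simp only [FlowState.bump]
    rw [hpow, abs_le]
    constructor <;> linarith

theorem Bdd.double {T : N.FlowState} {B : ℕ} (h : T.Bdd B) : T.double.Bdd (B + 1) := by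
  have hpow : (2 : ℤ) ^ (B + 1) = 2 * 2 ^ B := by ring
  have hpos : (0 : ℤ) ≤ 2 ^ B := by positivity
  refine ⟨fun e => ?_, fun e => ?_, fun v => ?_⟩
  · have := h.1 e
    simp only [FlowState.double, abs_mul, abs_two]
    linarith
  · have := h.2.1 e
    simp only [FlowState.double, abs_mul, abs_two]
    linarith
  · have := h.2.2 v
    simp only [FlowState.double]
    linarith

theorem Bdd.raise {c : Fin N.m → ℤ} {T : N.FlowState} {B : ℕ} (hc : ∀ e, |N.cost e| ≤ 2 ^ B)
    (h : T.Bdd B) (i : ℕ) : (raise c T i).Bdd (B + 2 * (N.n + 1) * i) := by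
  induction i with
  | zero => exact h
  | succ i ih =>
    rw [FlowState.raise]
    have hle : B + 2 * (N.n + 1) * i ≤ B + 2 * (N.n + 1) * (i + 1) :=
      Nat.add_le_add_left (Nat.mul_le_mul_left _ (by omega)) B
    split_ifs
    · exact (ih.bump (fun e => (hc e).trans (pow_le_pow_right₀ (by norm_num) (by omega))) _).mono
        (Eq.le (by ring))
    · exact ih.mono hle
    · exact ih.mono hle

/-- The growth in bits is additive: one bit for the doubling and `2 * (n + 1)` for each of at most
`m` unit raises per phase. -/
theorem scaling_bdd {c : Fin N.m → ℤ} {P B : ℕ} (hc : ∀ e, |N.cost e| ≤ 2 ^ B) (i : ℕ) :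
    (scaling c P i).Bdd (B + (2 * (N.n + 1) * N.m + 1) * i) := by
  induction i with
  | zero => exact zero_bdd _
  | succ i ih =>
    rw [scaling, phase]
    refine (ih.double.raise (fun e => (hc e).trans (pow_le_pow_right₀ (by norm_num) (by omega)))
      _).mono (Eq.le (by ring))

end FlowState

end Growth

end Network

/-! ### The circulation algorithm runs in polynomial time -/

namespace While

open Val ANF

/-- A vector of integers, as a list. -/
def encVec {r : ℕ} (g : Fin r → ℤ) : Val := encFun fun i => int (g i)

/-- Together with `abs_le_two_pow_size` this translates between bounds `2 ^ B` on numbers and bounds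
on encoded sizes. The number `2 ^ B` has `B + 1` digits, and the leaf adds 1. -/
theorem size_int_le_of_abs_le {a : ℤ} {B : ℕ} (h : |a| ≤ 2 ^ B) : (int a).size ≤ B + 2 := by
  have h1 : a.natAbs ≤ 2 ^ B := by
    have : (a.natAbs : ℤ) ≤ 2 ^ B := by rwa [Int.natCast_natAbs]
    exact_mod_cast this
  have h2 : a.natAbs.size ≤ B + 1 := by
    rw [Nat.size_le, pow_succ]
    have : 0 < 2 ^ B := by positivity
    omega
  simp only [size_int]
  omega

theorem abs_le_two_pow_size (a : ℤ) : |a| ≤ 2 ^ (int a).size := by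
  have h1 : a.natAbs < 2 ^ a.natAbs.size := Nat.lt_size_self _
  have h2 : 2 ^ a.natAbs.size ≤ 2 ^ (int a).size :=
    Nat.pow_le_pow_right (by norm_num) (by simp)
  have h3 : (a.natAbs : ℤ) ≤ ((2 ^ (int a).size : ℕ) : ℤ) := by exact_mod_cast h1.le.trans h2
  rw [Int.natCast_natAbs] at h3
  exact_mod_cast h3

theorem abs_le_two_pow_size_encVec {r B : ℕ} {g : Fin r → ℤ} (h : (encVec g).size ≤ B) (i : Fin r) :
    |g i| ≤ 2 ^ B :=
  (abs_le_two_pow_size (g i)).trans (pow_le_pow_right₀ (by norm_num)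
    ((size_le_size_encFun (fun i => int (g i)) i).trans h))

theorem size_encVec_le {r B : ℕ} {g : Fin r → ℤ} (h : ∀ i, |g i| ≤ 2 ^ B) :
    (encVec g).size ≤ 1 + r * (B + 3) :=
  (size_encFun_le fun i => size_int_le_of_abs_le (h i)).trans (Eq.le (by ring))

namespace PolyTime

variable {Γ Δ : Type} {e : Γ → Val} {r : Γ → ℕ}

theorem get_int {g : ∀ γ, Fin (r γ) → ℤ} {i : ∀ γ, Fin (r γ)}
    (hg : PolyTime e fun γ => encVec (g γ)) (hi : PolyTime e fun γ => encNat (i γ)) :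
    PolyTime e fun γ => int (g γ (i γ)) :=
  get (w := fun γ i => int (g γ i)) hg hi

theorem get_bool {g : ∀ γ, Fin (r γ) → Bool} {i : ∀ γ, Fin (r γ)}
    (hg : PolyTime e fun γ => encFun fun i => ofBool (g γ i))
    (hi : PolyTime e fun γ => encNat (i γ)) : PolyTime e fun γ => ofBool (g γ (i γ)) :=
  get (w := fun γ i => ofBool (g γ i)) hg hi

theorem get_fin {s : Γ → ℕ} {g : ∀ γ, Fin (r γ) → Fin (s γ)} {i : ∀ γ, Fin (r γ)}
    (hg : PolyTime e fun γ => encFun fun i => encNat (g γ i))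
    (hi : PolyTime e fun γ => encNat (i γ)) : PolyTime e fun γ => encNat (g γ (i γ)) :=
  get (w := fun γ i => encNat (g γ i)) hg hi

theorem get_vec {s : Γ → ℕ} {g : ∀ γ, Fin (r γ) → Fin (s γ) → ℤ} {i : ∀ γ, Fin (r γ)}
    (hg : PolyTime e fun γ => encFun fun i => encVec (g γ i))
    (hi : PolyTime e fun γ => encNat (i γ)) : PolyTime e fun γ => encVec (g γ (i γ)) :=
  get (w := fun γ i => encVec (g γ i)) hg hi

theorem fin_eq {i j : ∀ γ, Fin (r γ)} (hi : PolyTime e fun γ => encNat (i γ))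
    (hj : PolyTime e fun γ => encNat (j γ)) : PolyTime e fun γ => ofBool (decide (i γ = j γ)) :=
  (hi.eq hj).congr fun γ => congrArg ofBool (decide_eq_decide.2 (by
    rw [Nat.cast_inj, Fin.ext_iff]))

theorem tab_int {w : ∀ γ, Fin (r γ) → Val} {g : ∀ γ, Fin (r γ) → ℤ}
    (hw : PolyTime e fun γ => encFun (w γ))
    (hg : PolyTime (fun x : Σ γ, Fin (r γ) => .pair (e x.1) (encNat x.2))
      fun x => int (g x.1 x.2)) : PolyTime e fun γ => encVec (g γ) :=
  tab (g := fun γ i => int (g γ i)) hw hg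

theorem tab_bool {w : ∀ γ, Fin (r γ) → Val} {g : ∀ γ, Fin (r γ) → Bool}
    (hw : PolyTime e fun γ => encFun (w γ))
    (hg : PolyTime (fun x : Σ γ, Fin (r γ) => .pair (e x.1) (encNat x.2))
      fun x => ofBool (g x.1 x.2)) : PolyTime e fun γ => encFun fun i => ofBool (g γ i) :=
  tab (g := fun γ i => ofBool (g γ i)) hw hg

theorem ite_prop {p : Γ → Prop} [DecidablePred p] {x y : Γ → ℤ}
    (hp : PolyTime e fun γ => ofBool (decide (p γ)))
    (hx : PolyTime e fun γ => int (x γ)) (hy : PolyTime e fun γ => int (y γ)) :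
    PolyTime e fun γ => int (if p γ then x γ else y γ) :=
  (hp.ite_int hx hy).congr fun γ => by simp

end PolyTime

end While

namespace Network

open While Val ANF

variable {Γ Δ : Type} {e : Γ → Val} {N : Γ → Network}

/-- The data of a network are available in polynomial time. -/
structure Given (e : Γ → Val) (N : Γ → Network) : Prop where
  verts : PolyTime e fun γ => encFun fun v : Fin (N γ).n => encNat v
  tail : PolyTime e fun γ => encFun fun i => encNat ((N γ).tail i)
  head : PolyTime e fun γ => encFun fun i => encNat ((N γ).head i)
  cost : PolyTime e fun γ => encVec (N γ).cost

namespace Given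

theorem lift (h : Given e N) (ρ : Δ → Γ) (w : Δ → Val) :
    Given (fun δ => .pair (e (ρ δ)) (w δ)) fun δ => N (ρ δ) :=
  ⟨h.verts.lift ρ w, h.tail.lift ρ w, h.head.lift ρ w, h.cost.lift ρ w⟩

theorem redCost (h : Given e N) {π : ∀ γ, Fin (N γ).n → ℤ} {i : ∀ γ, Fin (N γ).m}
    (hπ : PolyTime e fun γ => encVec (π γ)) (hi : PolyTime e fun γ => encNat (i γ)) :
    PolyTime e fun γ => int ((N γ).redCost (π γ) (i γ)) :=
  ((h.cost.get_int hi).add (hπ.get_int (h.tail.get_fin hi))).sub (hπ.get_int (h.head.get_fin hi))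

end Given

def encSearch {N : Network} (S : N.Search) : Val :=
  .pair (encVec S.pot) (.pair (encFun fun v => ofBool (S.mem v)) (encFun fun v => encVec (S.aug v)))

/-- The data of a search are available in polynomial time. -/
structure SearchGiven (e : Γ → Val) (N : Γ → Network) (cap f : ∀ γ, Fin (N γ).m → ℤ)
    (e₀ : ∀ γ, Fin (N γ).m) (S : ∀ γ, (N γ).Search) : Prop where
  net : Given e N
  cap : PolyTime e fun γ => encVec (cap γ)
  flow : PolyTime e fun γ => encVec (f γ)
  edge : PolyTime e fun γ => encNat (e₀ γ)
  search : PolyTime e fun γ => encSearch (S γ)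

namespace SearchGiven

variable {cap f : ∀ γ, Fin (N γ).m → ℤ} {e₀ : ∀ γ, Fin (N γ).m} {S : ∀ γ, (N γ).Search}

theorem lift (h : SearchGiven e N cap f e₀ S) (ρ : Δ → Γ) (w : Δ → Val) :
    SearchGiven (fun δ => .pair (e (ρ δ)) (w δ)) (fun δ => N (ρ δ)) (fun δ => cap (ρ δ))
      (fun δ => f (ρ δ)) (fun δ => e₀ (ρ δ)) fun δ => S (ρ δ) :=
  ⟨h.net.lift ρ w, h.cap.lift ρ w, h.flow.lift ρ w, h.edge.lift ρ w, h.search.lift ρ w⟩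

theorem pot (h : SearchGiven e N cap f e₀ S) : PolyTime e fun γ => encVec (S γ).pot :=
  h.search.left

theorem mem (h : SearchGiven e N cap f e₀ S) :
    PolyTime e fun γ => encFun fun v => ofBool ((S γ).mem v) :=
  h.search.right.left

theorem aug (h : SearchGiven e N cap f e₀ S) :
    PolyTime e fun γ => encFun fun v => encVec ((S γ).aug v) :=
  h.search.right.right

theorem leaves (h : SearchGiven e N cap f e₀ S) {i : ∀ γ, Fin (N γ).m}
    (hi : PolyTime e fun γ => encNat (i γ)) :
    PolyTime e fun γ => ofBool (Network.leaves (cap γ) (f γ) (e₀ γ) (S γ) (i γ)) := by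
  have ht := h.mem.get_bool (h.net.tail.get_fin hi)
  have hh := h.mem.get_bool (h.net.head.get_fin hi)
  exact ht.ite_bool (hh.not.and ((h.flow.get_int hi).lt (h.cap.get_int hi)))
    (hh.and (((PolyTime.const e 0).lt (h.flow.get_int hi)).or (hi.fin_eq h.edge)))

theorem slack (h : SearchGiven e N cap f e₀ S) {i : ∀ γ, Fin (N γ).m}
    (hi : PolyTime e fun γ => encNat (i γ)) :
    PolyTime e fun γ => int (Network.slack (S γ) (i γ)) := by
  have hr := h.net.redCost h.pot hi
  exact (h.mem.get_bool (h.net.tail.get_fin hi)).ite_int hr hr.neg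

theorem choice (h : SearchGiven e N cap f e₀ S) :
    PolyTime e fun γ => encOption (fun i : Fin (N γ).m => encNat i)
      (Network.choice (cap γ) (f γ) (e₀ γ) (S γ)) := by
  refine h.net.tail.find ?_
  have h' := h.lift (Sigma.fst : (Σ γ, Fin (N γ).m) → Γ) fun x => encNat x.2
  have hi := (PolyTime.refl fun x : Σ γ, Fin (N γ).m => Val.pair (e x.1) (encNat x.2)).right
  refine (h'.leaves hi).and (h'.net.tail.any
    (p := fun (x : Σ γ, Fin (N γ).m) j => Network.leaves (cap x.1) (f x.1) (e₀ x.1) (S x.1) j &&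
      decide (Network.slack (S x.1) j < Network.slack (S x.1) x.2)) ?_).not
  -- The context now holds two edges: the candidate `y.1.2` and its competitor `y.2`.
  have h'' := h'.lift (Sigma.fst : (Σ x : (Σ γ, Fin (N γ).m), Fin (N x.1).m) → _)
    fun y => encNat y.2
  have hi' := hi.lift (Sigma.fst : (Σ x : (Σ γ, Fin (N γ).m), Fin (N x.1).m) → _)
    fun y => encNat y.2
  have hj := (PolyTime.refl fun y : Σ x : (Σ γ, Fin (N γ).m), Fin (N x.1).m =>
    Val.pair (Val.pair (e y.1.1) (encNat y.1.2)) (encNat y.2)).right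
  exact (h''.leaves hj).and ((h''.slack hj).lt (h''.slack hi'))

theorem advance (h : SearchGiven e N cap f e₀ S) {i : ∀ γ, Fin (N γ).m}
    (hi : PolyTime e fun γ => encNat (i γ)) :
    PolyTime e fun γ => encSearch (Network.advance (S γ) (i γ)) := by
  have h' := h.lift (Sigma.fst : (Σ γ, Fin (N γ).n) → Γ) fun x => encNat x.2
  have hi' := hi.lift (Sigma.fst : (Σ γ, Fin (N γ).n) → Γ) fun x => encNat x.2
  have hv := (PolyTime.refl fun x : Σ γ, Fin (N γ).n => Val.pair (e x.1) (encNat x.2)).right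
  have ht := h'.net.tail.get_fin hi'
  have hh := h'.net.head.get_fin hi'
  refine .pair (h.net.verts.tab_int ?_) (.pair (h.net.verts.tab_bool ?_) ?_)
  · exact (h'.mem.get_bool hv).ite_int (h'.pot.get_int hv)
      ((h'.pot.get_int hv).add (h'.slack hi'))
  · exact (h'.mem.get_bool hv).or ((hv.fin_eq ht).or (hv.fin_eq hh))
  · refine h.net.verts.tab (g := fun γ v => encVec ((Network.advance (S γ) (i γ)).aug v))
      (h'.net.tail.tab_int (g := fun x : Σ γ, Fin (N γ).n =>
        (Network.advance (S x.1) (i x.1)).aug x.2) ?_)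
    have h'' := h'.lift (Sigma.fst : (Σ x : (Σ γ, Fin (N γ).n), Fin (N x.1).m) → _)
      fun y => encNat y.2
    have hi'' := hi'.lift (Sigma.fst : (Σ x : (Σ γ, Fin (N γ).n), Fin (N x.1).m) → _)
      fun y => encNat y.2
    have hv' := hv.lift (Sigma.fst : (Σ x : (Σ γ, Fin (N γ).n), Fin (N x.1).m) → _)
      fun y => encNat y.2
    have hj := (PolyTime.refl fun y : Σ x : (Σ γ, Fin (N γ).n), Fin (N x.1).m =>
      Val.pair (Val.pair (e y.1.1) (encNat y.1.2)) (encNat y.2)).right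
    have ht' := h''.net.tail.get_fin hi''
    have hh' := h''.net.head.get_fin hi''
    exact (h''.mem.get_bool hv').ite_int ((h''.aug.get_vec hv').get_int hj)
      ((h''.mem.get_bool ht').ite_int
        (((h''.aug.get_vec ht').get_int hj).add
          ((hj.fin_eq hi'').ite_prop (.const _ 1) (.const _ 0)))
        (((h''.aug.get_vec hh').get_int hj).add
          ((hj.fin_eq hi'').ite_prop (.const _ (-1)) (.const _ 0))))

theorem searchStep (h : SearchGiven e N cap f e₀ S) :
    PolyTime e fun γ => encSearch (Network.searchStep (cap γ) (f γ) (e₀ γ) (S γ)) := by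
  have hfin : PolyTime e fun γ => ofBool (finished (e₀ γ) (S γ)) :=
    (h.mem.get_bool (h.net.tail.get_fin h.edge)).or
      ((PolyTime.const e 0).le (h.net.redCost h.pot h.edge))
  refine (hfin.ite h.search (g := fun γ => encSearch
    (match Network.choice (cap γ) (f γ) (e₀ γ) (S γ) with
    | none => S γ
    | some e => Network.advance (S γ) e)) ?_).congr fun γ => ?_
  · refine h.choice.option_cases ?_ ?_
    · exact (h.search.comap Subtype.val).congr fun x => by simp only [x.2]
    · refine ((h.lift (fun x : {x : Σ γ, Fin (N γ).m // Network.choice (cap x.1) (f x.1) (e₀ x.1)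
        (S x.1) = some x.2} => x.1.1) fun x => encNat x.1.2).advance
        (i := fun x => x.1.2) (PolyTime.refl _).right).congr fun x => ?_
      simp only [x.2]
  · simp only [Network.searchStep]
    split_ifs
    · rfl
    · cases Network.choice (cap γ) (f γ) (e₀ γ) (S γ) <;> rfl

end SearchGiven

theorem size_encSearch_le {N : Network} {S : N.Search} {B : ℕ} (h : S.Bdd B) :
    (encSearch S).size ≤ 5 + N.n * (B + 3) + N.n * 3 + N.n * (2 + N.m * (B + 3)) := by
  have h1 := size_encVec_le h.1
  have h2 := size_encFun_le (w := fun v => ofBool (S.mem v)) fun v => size_ofBool_le _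
  have h3 := size_encFun_le (w := fun v => encVec (S.aug v)) fun v => size_encVec_le (h.2 v)
  have h4 : N.n * (1 + (1 + N.m * (B + 3))) = N.n * (2 + N.m * (B + 3)) := by ring
  simp only [encSearch, size_pair]
  omega

theorem Given.search (h : Given e N) {cap f : ∀ γ, Fin (N γ).m → ℤ} {e₀ : ∀ γ, Fin (N γ).m}
    {π : ∀ γ, Fin (N γ).n → ℤ} (hcap : PolyTime e fun γ => encVec (cap γ))
    (hf : PolyTime e fun γ => encVec (f γ)) (he₀ : PolyTime e fun γ => encNat (e₀ γ))
    (hπ : PolyTime e fun γ => encVec (π γ)) :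
    PolyTime e fun γ => encSearch (Network.search (cap γ) (f γ) (e₀ γ) (π γ) (N γ).n) := by
  -- The list of vertices serves only as a counter for the `n` steps.
  refine h.verts.fold (a := fun γ i => encSearch (Network.search (cap γ) (f γ) (e₀ γ) (π γ) i))
    ?_ ?_ ?_
  · refine hπ.pair (.pair (h.verts.tab_bool ?_)
      (h.verts.tab (g := fun γ _ => encVec (f γ)) (hf.lift Sigma.fst _)))
    have hv := (PolyTime.refl fun x : Σ γ, Fin (N γ).n => Val.pair (e x.1) (encNat x.2)).right
    exact hv.fin_eq ((h.head.get_fin he₀).lift Sigma.fst _)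
  -- The input sizes bound the bits of costs, flow and potentials at the start; the last summand
  -- covers two bits per step.
  · let B : Γ → ℕ := fun γ => (encVec (N γ).cost).size + (encVec (f γ)).size +
      (encVec (π γ)).size + 2 * (N γ).n
    have hB : PolyBdd (fun γ => (e γ).size) B :=
      ((h.cost.sizeBdd.add hf.sizeBdd).add hπ.sizeBdd).add
        ((PolyBdd.const _ 2).mul h.verts.length_bdd)
    have hn := h.verts.length_bdd
    have hm := h.tail.length_bdd
    have hB3 := hB.add (.const _ 3)
    refine PolyBdd.mono (PolyBdd.comap (((((PolyBdd.const _ 5).add (hn.mul hB3)).add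
      (hn.mul (.const _ 3))).add (hn.mul ((PolyBdd.const _ 2).add (hm.mul hB3))))) Sigma.fst)
      fun x => size_encSearch_le ((search_bdd (B := (encVec (N x.1).cost).size +
        (encVec (f x.1)).size + (encVec (π x.1)).size) ?_ ?_ ?_ x.2).mono ?_)
    · exact abs_le_two_pow_size_encVec (by omega)
    · exact abs_le_two_pow_size_encVec (by omega)
    · exact abs_le_two_pow_size_encVec (by omega)
    · have := x.2.2
      simp only [B]
      omega
  · have hS : SearchGiven (fun x : Σ γ, Fin (N γ).n => .pair (e x.1) (.pair (encNat x.2)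
        (encSearch (Network.search (cap x.1) (f x.1) (e₀ x.1) (π x.1) x.2))))
        (fun x => N x.1) (fun x => cap x.1) (fun x => f x.1) (fun x => e₀ x.1)
        (fun x => Network.search (cap x.1) (f x.1) (e₀ x.1) (π x.1) x.2) :=
      ⟨h.lift Sigma.fst _, hcap.lift Sigma.fst _, hf.lift Sigma.fst _, he₀.lift Sigma.fst _,
        (PolyTime.refl _).right.right⟩
    refine hS.searchStep.congr fun x => ?_
    simp only [Network.search]
    rw [Function.iterate_succ_apply']

def encState {N : Network} (T : N.FlowState) : Val :=
  .pair (encVec T.cap) (.pair (encVec T.flow) (encVec T.pot))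

theorem size_encState_le {N : Network} {T : N.FlowState} {B : ℕ} (h : T.Bdd B) :
    (encState T).size ≤ 5 + N.m * (B + 3) + N.m * (B + 3) + N.n * (B + 3) := by
  have h1 := size_encVec_le h.1
  have h2 := size_encVec_le h.2.1
  have h3 := size_encVec_le h.2.2
  simp only [encState, size_pair]
  omega

namespace Given

theorem bump (h : Given e N) {T : ∀ γ, (N γ).FlowState} {i : ∀ γ, Fin (N γ).m}
    (hT : PolyTime e fun γ => encState (T γ)) (hi : PolyTime e fun γ => encNat (i γ)) :
    PolyTime e fun γ => encState ((T γ).bump (i γ)) := by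
  have hS := h.search hT.left hT.right.left hi hT.right.right
  have hj := (PolyTime.refl fun x : Σ γ, Fin (N γ).m => Val.pair (e x.1) (encNat x.2)).right
  have hi' := hi.lift (Sigma.fst : (Σ γ, Fin (N γ).m) → Γ) fun x => encNat x.2
  have hT' := hT.lift (Sigma.fst : (Σ γ, Fin (N γ).m) → Γ) fun x => encNat x.2
  have hS' := hS.lift (Sigma.fst : (Σ γ, Fin (N γ).m) → Γ) fun x => encNat x.2
  have h' := h.lift (Sigma.fst : (Σ γ, Fin (N γ).m) → Γ) fun x => encNat x.2
  have hone := (hj.fin_eq hi').ite_prop (.const _ 1) (.const _ 0)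
  refine .pair (h.tail.tab_int ?_) (.pair (h.tail.tab_int ?_) hS.left)
  · exact (hT'.left.get_int hj).add hone
  · exact ((PolyTime.const _ 0).le (h'.redCost hS'.left hi')).ite_prop (hT'.right.left.get_int hj)
      (((hS'.right.right.get_vec (h'.tail.get_fin hi')).get_int hj).add hone)

theorem raise (h : Given e N) {c : ∀ γ, Fin (N γ).m → ℤ} {T : ∀ γ, (N γ).FlowState}
    (hc : PolyTime e fun γ => encVec (c γ)) (hT : PolyTime e fun γ => encState (T γ)) :
    PolyTime e fun γ => encState ((T γ).raise (c γ) (N γ).m) := by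
  refine h.tail.fold (a := fun γ i => encState ((T γ).raise (c γ) i)) hT ?_ ?_
  · let B : Γ → ℕ := fun γ => (encVec (N γ).cost).size + (encState (T γ)).size
    let C : Γ → ℕ := fun γ => B γ + 2 * ((N γ).n + 1) * (N γ).m
    have hn := h.verts.length_bdd
    have hm := h.tail.length_bdd
    have hC : PolyBdd (fun γ => (e γ).size) C := (h.cost.sizeBdd.add hT.sizeBdd).add
      (((PolyBdd.const _ 2).mul (hn.add (.const _ 1))).mul hm)
    have hC3 := hC.add (.const _ 3)
    refine PolyBdd.mono (PolyBdd.comap ((((PolyBdd.const _ 5).add (hm.mul hC3)).add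
      (hm.mul hC3)).add (hn.mul hC3)) Sigma.fst) fun x => size_encState_le
        ((FlowState.Bdd.raise (B := B x.1) ?_ ⟨?_, ?_, ?_⟩ x.2).mono ?_)
    · exact abs_le_two_pow_size_encVec (by simp only [B]; omega)
    · exact abs_le_two_pow_size_encVec (by simp only [B, encState, size_pair]; omega)
    · exact abs_le_two_pow_size_encVec (by simp only [B, encState, size_pair]; omega)
    · exact abs_le_two_pow_size_encVec (by simp only [B, encState, size_pair]; omega)
    · exact Nat.add_le_add_left (Nat.mul_le_mul_left _ (Nat.lt_succ_iff.1 x.2.2)) _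
  · have hT' := (PolyTime.refl fun x : Σ γ, Fin (N γ).m => Val.pair (e x.1)
      (.pair (encNat x.2) (encState ((T x.1).raise (c x.1) x.2)))).right.right
    have hi := (PolyTime.refl fun x : Σ γ, Fin (N γ).m => Val.pair (e x.1)
      (.pair (encNat x.2) (encState ((T x.1).raise (c x.1) x.2)))).right.left
    have hc' := hc.lift (Sigma.fst : (Σ γ, Fin (N γ).m) → Γ) fun x =>
      .pair (encNat x.2) (encState ((T x.1).raise (c x.1) x.2))
    have h' := h.lift (Sigma.fst : (Σ γ, Fin (N γ).m) → Γ) fun x =>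
      .pair (encNat x.2) (encState ((T x.1).raise (c x.1) x.2))
    refine (((hT'.left.get_int hi).lt (hc'.get_int hi)).ite (h'.bump hT' hi) hT').congr fun x => ?_
    simp only [FlowState.raise, x.2.2, dite_true, decide_eq_true_eq]
    split_ifs <;> rfl

theorem phase (h : Given e N) {c : ∀ γ, Fin (N γ).m → ℤ} {p : Γ → ℤ} {T : ∀ γ, (N γ).FlowState}
    (hc : PolyTime e fun γ => encVec (c γ)) (hp : PolyTime e fun γ => int (p γ))
    (hT : PolyTime e fun γ => encState (T γ)) :
    PolyTime e fun γ => encState ((T γ).phase (c γ) (p γ)) := by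
  have hj := (PolyTime.refl fun x : Σ γ, Fin (N γ).m => Val.pair (e x.1) (encNat x.2)).right
  have hc' := hc.lift (Sigma.fst : (Σ γ, Fin (N γ).m) → Γ) fun x => encNat x.2
  have hp' := hp.lift (Sigma.fst : (Σ γ, Fin (N γ).m) → Γ) fun x => encNat x.2
  have hT' := hT.lift (Sigma.fst : (Σ γ, Fin (N γ).m) → Γ) fun x => encNat x.2
  refine h.raise (T := fun γ => (T γ).double) (c := fun γ e => c γ e / p γ) ?_
    (.pair ?_ (.pair ?_ hT.right.right))
  · exact h.tail.tab_int ((hc'.get_int hj).div hp')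
  · exact h.tail.tab_int ((PolyTime.const _ 2).mul (hT'.left.get_int hj))
  · exact h.tail.tab_int ((PolyTime.const _ 2).mul (hT'.right.left.get_int hj))

/-- Halving `P` drives the phases: the number held before phase `i` is `P / 2 ^ i`, exactly the
divisor of that phase. -/
theorem scaling (h : Given e N) {c : ∀ γ, Fin (N γ).m → ℤ} {P : Γ → ℕ}
    (hc : PolyTime e fun γ => encVec (c γ)) (hP : PolyTime e fun γ => encNat (P γ)) :
    PolyTime e fun γ => encState (FlowState.scaling (N := N γ) (c γ) (P γ) (P γ).size) := by
  refine hP.halving (a := fun γ i => encState (FlowState.scaling (N := N γ) (c γ) (P γ) i)) ?_ ?_ ?_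
  · exact .pair (h.tail.tab_int (.const _ 0)) (.pair (h.tail.tab_int (.const _ 0))
      (h.verts.tab_int (.const _ 0)))
  · let C : Γ → ℕ := fun γ => (encVec (N γ).cost).size +
      (2 * ((N γ).n + 1) * (N γ).m + 1) * (P γ).size
    have hn := h.verts.length_bdd
    have hm := h.tail.length_bdd
    have hPs : PolyBdd (fun γ => (e γ).size) fun γ => (P γ).size :=
      hP.sizeBdd.mono fun γ => by simp [encNat]
    have hC : PolyBdd (fun γ => (e γ).size) C := h.cost.sizeBdd.add
      (((((PolyBdd.const _ 2).mul (hn.add (.const _ 1))).mul hm).add (.const _ 1)).mul hPs)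
    have hC3 := hC.add (.const _ 3)
    refine PolyBdd.mono (PolyBdd.comap ((((PolyBdd.const _ 5).add (hm.mul hC3)).add
      (hm.mul hC3)).add (hn.mul hC3)) Sigma.fst) fun x => size_encState_le
        ((FlowState.scaling_bdd (B := (encVec (N x.1).cost).size) ?_ x.2).mono ?_)
    · exact abs_le_two_pow_size_encVec le_rfl
    · exact Nat.add_le_add_left (Nat.mul_le_mul_left _ (Nat.lt_succ_iff.1 x.2.2)) _
  · exact (h.lift (Sigma.fst : (Σ γ, Fin (P γ).size) → Γ) _).phase (hc.lift Sigma.fst _)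
      (PolyTime.refl _).right.left (PolyTime.refl _).right.right

end Given

end Network

/-! ### The separation oracle -/

namespace ANF

open While Val Network

/-- A number is at most an infimum iff it is at most every member, so attainment plays no role. As
`z i` is finite, it may be moved across the inequality in `EReal`, also when the infimum is `⊤`. -/
theorem Instance.dualFeasible_iff_minCost (I : Instance) (ℓ : Fin I.m → ℝ) (z : Fin I.k → ℝ)
    (hℓ : ∀ e, 0 ≤ ℓ e) (hz : ∀ i, 0 ≤ z i) :
    I.DualFeasible ℓ z ↔ ∀ i, ((I.weight i : ℝ) : EReal) ≤ (z i : EReal) + I.minCost ℓ i := by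
  have key : ∀ i, ((I.weight i : ℝ) : EReal) ≤ (z i : EReal) + I.minCost ℓ i ↔
      ∀ f ∈ I.validFlows i, (I.weight i : ℝ) ≤ z i + ∑ e, f e * ℓ e := fun i => by
    have h1 : ((I.weight i : ℝ) : EReal) ≤ (z i : EReal) + I.minCost ℓ i ↔
        (((I.weight i : ℝ) - z i : ℝ) : EReal) ≤ I.minCost ℓ i := by
      rw [add_comm, EReal.coe_sub, EReal.sub_le_iff_le_add (by simp) (by simp)]
    rw [h1, Instance.minCost, le_iInf₂_iff]
    refine forall₂_congr fun f _ => ?_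
    rw [EReal.coe_le_coe_iff, Instance.cost, sub_le_iff_le_add']
  simp only [key]
  exact ⟨fun h => h.1, fun h => ⟨h, hℓ, hz⟩⟩

/-! ### The flow of a pair as a circulation through a return edge. -/

namespace Query

variable (Q : Query)

/-- A common denominator of the edge lengths. -/
def commonDen : ℤ := ∏ e, ((Q.len e).den : ℤ)

/-- The edge lengths, scaled to integers. -/
def scaledLen (e : Fin Q.inst.m) : ℤ := (Q.len e).num * (Q.commonDen / (Q.len e).den)

theorem commonDen_pos : 0 < Q.commonDen :=
  Finset.prod_pos fun e _ => by exact_mod_cast (Q.len e).den_pos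

theorem scaledLen_cast (e : Fin Q.inst.m) :
    (Q.scaledLen e : ℝ) = Q.commonDen * Q.lenReal e := by
  have hden : ((Q.len e).den : ℤ) ≠ 0 := by exact_mod_cast (Q.len e).den_ne_zero
  obtain ⟨c, hc⟩ : ((Q.len e).den : ℤ) ∣ Q.commonDen :=
    Finset.dvd_prod_of_mem (fun e => ((Q.len e).den : ℤ)) (Finset.mem_univ e)
  have h1 : Q.commonDen / (Q.len e).den = c := by
    rw [hc, Int.mul_ediv_cancel_left _ hden]
  have h2 : (Q.lenReal e) = ((Q.len e).num : ℝ) / ((Q.len e).den : ℝ) := by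
    rw [lenReal]
    exact Rat.cast_def (Q.len e)
  have hden' : ((Q.len e).den : ℝ) ≠ 0 := by exact_mod_cast (Q.len e).den_ne_zero
  rw [scaledLen, h1, h2, hc]
  push_cast
  field_simp

/-- The cost of the return edge is minus this number, which exceeds the cost of every flow. -/
def penalty : ℤ := 1 + ∑ e, (Q.inst.cap e : ℤ) * Q.scaledLen e

/-- The network with an additional edge from the target to the source of pair `i`. -/
def returnNetwork (i : Fin Q.inst.k) : Network where
  n := Q.inst.n
  m := Q.inst.m + 1
  tail := Fin.cons (Q.inst.target i) Q.inst.tail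
  head := Fin.cons (Q.inst.source i) Q.inst.head
  cost := Fin.cons (-Q.penalty) Q.scaledLen

/-- The return edge has the demand as its capacity. -/
def returnCap (i : Fin Q.inst.k) : Fin (Q.returnNetwork i).m → ℤ :=
  Fin.cons (α := fun _ => ℤ) (Q.inst.demand i : ℤ) fun e => (Q.inst.cap e : ℤ)

/-- A bound on all capacities. -/
def capBound (i : Fin Q.inst.k) : ℕ := Q.inst.demand i + ∑ e, Q.inst.cap e

/-- The minimum-cost circulation. -/
def circulation (i : Fin Q.inst.k) : (Q.returnNetwork i).FlowState :=
  FlowState.scaling (Q.returnCap i) (2 ^ (Q.capBound i).size) (2 ^ (Q.capBound i).size).size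

theorem circulation_valid (i : Fin Q.inst.k) : (Q.circulation i).Valid :=
  FlowState.scaling_valid _ _ _

theorem circulation_cap (i : Fin Q.inst.k) : (Q.circulation i).cap = Q.returnCap i := by
  funext e
  -- The number `2 ^ L` has `L + 1` digits, one for each phase.
  rw [circulation, Nat.size_pow]
  refine FlowState.scaling_cap_eq (fun e => ?_) e
  have hlt : (Q.capBound i : ℤ) < 2 ^ (Q.capBound i).size := by
    exact_mod_cast Nat.lt_size_self (Q.capBound i)
  have hb : (Q.capBound i : ℤ) = Q.inst.demand i + ∑ e, (Q.inst.cap e : ℤ) := by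
    rw [capBound]
    push_cast
    rfl
  have hs : (0 : ℤ) ≤ ∑ e, (Q.inst.cap e : ℤ) := Finset.sum_nonneg fun _ _ => by positivity
  refine Fin.cases ?_ (fun e => ?_) e
  · simp only [returnCap, Fin.cons_zero]
    omega
  · have := Finset.single_le_sum (f := fun e => (Q.inst.cap e : ℤ)) (fun _ _ => by positivity)
      (Finset.mem_univ e)
    simp only [returnCap, Fin.cons_succ] at this ⊢
    omega

/-- The flow on the return edge. -/
def returnFlow (i : Fin Q.inst.k) : ℤ := (Q.circulation i).flow (0 : Fin (Q.inst.m + 1))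

/-- The flow on the edges of the instance. -/
def edgeFlow (i : Fin Q.inst.k) (e : Fin Q.inst.m) : ℤ := (Q.circulation i).flow e.succ

theorem edgeFlow_bounds (i : Fin Q.inst.k) (e : Fin Q.inst.m) :
    0 ≤ Q.edgeFlow i e ∧ Q.edgeFlow i e ≤ Q.inst.cap e := by
  have h := (Q.circulation_valid i).1 e.succ
  rw [circulation_cap] at h
  exact ⟨h.1, h.2.1⟩

theorem returnFlow_bounds (i : Fin Q.inst.k) :
    0 ≤ Q.returnFlow i ∧ Q.returnFlow i ≤ Q.inst.demand i := by
  have h := (Q.circulation_valid i).1 (0 : Fin (Q.inst.m + 1))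
  rw [circulation_cap] at h
  exact ⟨h.1, h.2.1⟩

theorem div_returnNetwork (i : Fin Q.inst.k) (g : Fin (Q.inst.m + 1) → ℝ) (v : Fin Q.inst.n) :
    (Q.returnNetwork i).div g v =
      g 0 * ((if Q.inst.target i = v then 1 else 0) - (if Q.inst.source i = v then 1 else 0)) +
      (Q.inst.outflow (fun e => g e.succ) v - Q.inst.inflow (fun e => g e.succ) v) := by
  have h : (Q.returnNetwork i).div g v = ∑ e : Fin (Q.inst.m + 1),
      g e * ((if (Fin.cons (Q.inst.target i) Q.inst.tail : Fin (Q.inst.m + 1) → _) e = v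
        then 1 else 0) -
      (if (Fin.cons (Q.inst.source i) Q.inst.head : Fin (Q.inst.m + 1) → _) e = v
        then 1 else 0)) := rfl
  rw [h, Fin.sum_univ_succ]
  simp only [Fin.cons_zero, Fin.cons_succ, Instance.outflow, Instance.inflow, Finset.sum_filter]
  rw [← Finset.sum_sub_distrib]
  congr 1
  refine Finset.sum_congr rfl fun e _ => ?_
  split_ifs <;> ring

theorem sum_cost_returnNetwork (i : Fin Q.inst.k) (g : Fin (Q.inst.m + 1) → ℝ) :
    ∑ e : Fin (Q.inst.m + 1), g e * (((Q.returnNetwork i).cost e : ℤ) : ℝ) =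
      -(g 0 * Q.penalty) + Q.commonDen * ∑ e, g e.succ * Q.lenReal e := by
  rw [Fin.sum_univ_succ, Finset.mul_sum]
  have h0 : (Q.returnNetwork i).cost (0 : Fin (Q.inst.m + 1)) = -Q.penalty := rfl
  have h1 : ∀ e : Fin Q.inst.m, (Q.returnNetwork i).cost e.succ = Q.scaledLen e := fun _ => rfl
  rw [h0]
  push_cast
  congr 1
  · ring
  · refine Finset.sum_congr rfl fun e _ => ?_
    rw [h1, scaledLen_cast]
    ring

theorem div_circulation (i : Fin Q.inst.k) (v : Fin Q.inst.n) :
    (Q.returnNetwork i).div (fun e => ((Q.circulation i).flow e : ℝ)) v = 0 := by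
  have h := (Q.circulation_valid i).2 v
  simp only [Network.div] at h ⊢
  exact_mod_cast congrArg (Int.cast : ℤ → ℝ) h

/-- The circulation is at least as good as every valid flow that is closed by the return edge. -/
theorem circulation_cost_le (i : Fin Q.inst.k) {g : Fin Q.inst.m → ℝ}
    (hg : g ∈ Q.inst.validFlows i) :
    -((Q.returnFlow i : ℝ) * Q.penalty) +
        Q.commonDen * ∑ e, (Q.edgeFlow i e : ℝ) * Q.lenReal e ≤
      -((Q.inst.demand i : ℝ) * Q.penalty) + Q.commonDen * ∑ e, g e * Q.lenReal e := by
  have h := (Q.circulation_valid i).1.cost_le (Q.circulation_valid i).2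
    (g := Fin.cons (α := fun _ => ℝ) (Q.inst.demand i : ℝ) g) ?_ ?_
  · have h1 := Q.sum_cost_returnNetwork i fun e => ((Q.circulation i).flow e : ℝ)
    have h2 := Q.sum_cost_returnNetwork i (Fin.cons (α := fun _ => ℝ) (Q.inst.demand i : ℝ) g)
    simp only [Fin.cons_zero, Fin.cons_succ] at h2
    exact h1.symm.le.trans (h.trans h2.le)
  · rw [circulation_cap]
    refine Fin.cases ?_ fun e => ?_
    · simp [returnCap]
    · simpa [returnCap] using hg.1 e
  · intro (v : Fin Q.inst.n)
    have h := hg.2 v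
    refine (Q.div_returnNetwork i (Fin.cons (α := fun _ => ℝ) (Q.inst.demand i : ℝ) g) v).trans ?_
    simp only [Fin.cons_zero, Fin.cons_succ]
    rw [h]
    simp only [eq_comm (a := v)]
    split_ifs <;> ring

theorem edgeFlow_valid (i : Fin Q.inst.k) (h : Q.returnFlow i = Q.inst.demand i) :
    (fun e => (Q.edgeFlow i e : ℝ)) ∈ Q.inst.validFlows i := by
  refine ⟨fun e => ?_, fun v => ?_⟩
  · have := Q.edgeFlow_bounds i e
    exact ⟨Int.cast_nonneg this.1, by simpa using (Int.cast_le (R := ℝ)).2 this.2⟩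
  · have h1 := Q.div_circulation i v
    have h2 := h1.symm.trans
      (Q.div_returnNetwork i (fun e => ((Q.circulation i).flow e : ℝ)) v)
    have h3 : ((Q.circulation i).flow (0 : Fin (Q.inst.m + 1)) : ℝ) = Q.inst.demand i := by
      exact_mod_cast congrArg (Int.cast : ℤ → ℝ) h
    rw [h3] at h2
    simp only [eq_comm (a := v)]
    simp only [edgeFlow]
    split_ifs at h2 ⊢ <;> linarith

/-- With a saturated return edge the penalty terms of both circulations coincide and cancel; what
remains is the cost comparison times the positive common denominator. -/
theorem edgeFlow_minCost (i : Fin Q.inst.k) (h : Q.returnFlow i = Q.inst.demand i) :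
    Q.inst.IsMinCostFlow Q.lenReal i fun e => (Q.edgeFlow i e : ℝ) := by
  refine ⟨Q.edgeFlow_valid i h, fun g hg => ?_⟩
  have h1 := Q.circulation_cost_le i hg
  have hD : (0 : ℝ) < Q.commonDen := by exact_mod_cast Q.commonDen_pos
  rw [h] at h1
  push_cast at h1
  exact le_of_mul_le_mul_left (by simpa [Instance.cost] using h1) hD

/-- By integrality an unsaturated return edge lacks at least one unit, which costs at least the
penalty. Closing up a valid flow would save this at a price of at most the penalty minus 1,
contradicting optimality. -/
theorem validFlows_eq_empty (hℓ : ∀ e, 0 ≤ Q.lenReal e) (i : Fin Q.inst.k)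
    (h : Q.returnFlow i ≠ Q.inst.demand i) : Q.inst.validFlows i = ∅ := by
  refine Set.eq_empty_iff_forall_notMem.2 fun g hg => ?_
  have h1 := Q.circulation_cost_le i hg
  have h2 : (Q.returnFlow i : ℝ) ≤ Q.inst.demand i - 1 := by
    have h3 := (Q.returnFlow_bounds i).2
    have h4 : Q.returnFlow i ≤ (Q.inst.demand i : ℤ) - 1 := by omega
    exact_mod_cast h4
  have hD : (0 : ℝ) < Q.commonDen := by exact_mod_cast Q.commonDen_pos
  have hM : (Q.penalty : ℝ) = 1 + Q.commonDen * ∑ e, (Q.inst.cap e : ℝ) * Q.lenReal e := by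
    rw [penalty, Finset.mul_sum]
    push_cast
    congr 1
    refine Finset.sum_congr rfl fun e _ => ?_
    rw [scaledLen_cast]
    ring
  have h5 : ∑ e, g e * Q.lenReal e ≤ ∑ e, (Q.inst.cap e : ℝ) * Q.lenReal e :=
    Finset.sum_le_sum fun e _ => mul_le_mul_of_nonneg_right (hg.1 e).2 (hℓ e)
  have h6 : 0 ≤ ∑ e, (Q.edgeFlow i e : ℝ) * Q.lenReal e :=
    Finset.sum_nonneg fun e _ => mul_nonneg (by exact_mod_cast (Q.edgeFlow_bounds i e).1) (hℓ e)
  have h7 : 0 ≤ ∑ e, (Q.inst.cap e : ℝ) * Q.lenReal e :=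
    Finset.sum_nonneg fun e _ => mul_nonneg (by positivity) (hℓ e)
  have h8 := mul_le_mul_of_nonneg_left h5 hD.le
  have h9 := mul_nonneg hD.le h6
  have h10 := mul_nonneg hD.le h7
  have h11 : (1 : ℝ) * Q.penalty ≤ (Q.inst.demand i - Q.returnFlow i) * Q.penalty :=
    mul_le_mul_of_nonneg_right (by linarith) (by rw [hM]; linarith)
  linarith

/-- The minimum-cost flow of pair `i`. -/
def flowOf (i : Fin Q.inst.k) : Option (Fin Q.inst.m → ℕ) :=
  if Q.returnFlow i = Q.inst.demand i then some fun e => (Q.edgeFlow i e).toNat else none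

theorem toNat_edgeFlow (i : Fin Q.inst.k) (e : Fin Q.inst.m) :
    (((Q.edgeFlow i e).toNat : ℕ) : ℤ) = Q.edgeFlow i e :=
  Int.toNat_of_nonneg (Q.edgeFlow_bounds i e).1

theorem flowOf_correct (hℓ : ∀ e, 0 ≤ Q.lenReal e) (i : Fin Q.inst.k) :
    Q.CorrectFlow i (Q.flowOf i) := by
  unfold flowOf
  split_ifs with h
  · have h1 : (fun e => (((Q.edgeFlow i e).toNat : ℕ) : ℝ)) = fun e => (Q.edgeFlow i e : ℝ) := by
      funext e
      exact_mod_cast congrArg (Int.cast : ℤ → ℝ) (Q.toNat_edgeFlow i e)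
    simp only [CorrectFlow, h1]
    exact Q.edgeFlow_minCost i h
  · exact Q.validFlows_eq_empty hℓ i h

/-- The constraint of pair `i` and its minimum-cost flow is violated. -/
def violated (i : Fin Q.inst.k) : Bool :=
  decide (Q.returnFlow i = Q.inst.demand i) &&
    decide ((Q.z i).num * (Q.inst.weight i).den * Q.commonDen +
        (∑ e, Q.edgeFlow i e * Q.scaledLen e) * (Q.z i).den * (Q.inst.weight i).den <
      (Q.inst.weight i).num * (Q.z i).den * Q.commonDen)

/-- The integer test is the rational inequality multiplied by the positive denominators of `z i` and
of the weight and by `commonDen`. -/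
theorem violated_iff (i : Fin Q.inst.k) : Q.violated i = true ↔
    Q.returnFlow i = Q.inst.demand i ∧
      Q.zReal i + ∑ e, (Q.edgeFlow i e : ℝ) * Q.lenReal e < (Q.inst.weight i : ℝ) := by
  rw [violated, Bool.and_eq_true, decide_eq_true_eq, decide_eq_true_eq]
  refine and_congr_right fun _ => ?_
  have hD : (0 : ℝ) < Q.commonDen := by exact_mod_cast Q.commonDen_pos
  have hz : (0 : ℝ) < (Q.z i).den := by exact_mod_cast (Q.z i).den_pos
  have hw : (0 : ℝ) < (Q.inst.weight i).den := by exact_mod_cast (Q.inst.weight i).den_pos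
  have h1 : Q.zReal i = ((Q.z i).num : ℝ) / (Q.z i).den := by
    rw [zReal]
    exact Rat.cast_def (Q.z i)
  have h2 : (Q.inst.weight i : ℝ) = ((Q.inst.weight i).num : ℝ) / (Q.inst.weight i).den :=
    Rat.cast_def (Q.inst.weight i)
  have h3 : ((∑ e, Q.edgeFlow i e * Q.scaledLen e : ℤ) : ℝ) =
      Q.commonDen * ∑ e, (Q.edgeFlow i e : ℝ) * Q.lenReal e := by
    rw [Finset.mul_sum]
    push_cast
    refine Finset.sum_congr rfl fun e _ => ?_
    rw [scaledLen_cast]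
    ring
  rw [← Int.cast_lt (R := ℝ), h1, h2]
  push_cast at h3 ⊢
  rw [h3]
  generalize ∑ e, (Q.edgeFlow i e : ℝ) * Q.lenReal e = C
  rw [div_add' _ _ _ hz.ne', div_lt_div_iff₀ hz hw]
  refine Iff.trans ?_ (mul_lt_mul_iff_left₀ hD)
  ring_nf

/-- The answer of the oracle. -/
def answer : Answer Q :=
  match (List.finRange Q.inst.m).find? fun e => decide ((Q.len e).num < 0) with
  | some e => .negLen e
  | none =>
    match (List.finRange Q.inst.k).find? fun i => decide ((Q.z i).num < 0) with
    | some i => .negZ i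
    | none => .checked Q.flowOf ((List.finRange Q.inst.k).find? Q.violated)

theorem answer_correct : Answer.Correct Q Q.answer := by
  unfold answer
  split
  · rename_i e he
    have h := List.find?_some he
    simp only [decide_eq_true_eq, Rat.num_neg] at h
    simp only [Answer.Correct, lenReal]
    exact_mod_cast h
  · rename_i hlen
    have hℓ : ∀ e, 0 ≤ Q.lenReal e := fun e => by
      have h := List.find?_eq_none.1 hlen e (List.mem_finRange e)
      simp only [decide_eq_true_eq, Rat.num_neg, not_lt] at h
      simp only [lenReal]
      exact_mod_cast h
    split
    · rename_i i hi
      have h := List.find?_some hi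
      simp only [decide_eq_true_eq, Rat.num_neg] at h
      simp only [Answer.Correct, zReal]
      exact_mod_cast h
    · rename_i hz'
      have hz : ∀ i, 0 ≤ Q.zReal i := fun i => by
        have h := List.find?_eq_none.1 hz' i (List.mem_finRange i)
        simp only [decide_eq_true_eq, Rat.num_neg, not_lt] at h
        simp only [zReal]
        exact_mod_cast h
      refine ⟨hℓ, hz, Q.flowOf_correct hℓ, ?_⟩
      split
      · rename_i hv
        -- A pair with a valid flow has a saturated return edge, and its constraint is tightest at
        -- the computed flow, where it was tested.
        refine ⟨fun i f hf => ?_, hℓ, hz⟩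
        have h1 := List.find?_eq_none.1 hv i (List.mem_finRange i)
        have h2 : Q.returnFlow i = Q.inst.demand i := by
          by_contra hne
          rw [Q.validFlows_eq_empty hℓ i hne] at hf
          exact hf
        rw [violated_iff, not_and, not_lt] at h1
        have h3 := (Q.edgeFlow_minCost i h2).2 f hf
        simp only [Instance.cost] at h3
        linarith [h1 h2]
      · rename_i i hv
        have h1 := (Q.violated_iff i).1 (List.find?_some hv)
        refine ⟨fun e => (Q.edgeFlow i e).toNat, by simp [flowOf, h1.1], ?_⟩
        refine lt_of_eq_of_lt ?_ h1.2
        congr 1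
        refine Finset.sum_congr rfl fun e _ => ?_
        congr 1
        exact_mod_cast congrArg (Int.cast : ℤ → ℝ) (Q.toNat_edgeFlow i e)

end Query

end ANF

/-! ### The oracle runs in polynomial time -/

namespace ANF

open While Val Network

theorem encFun_succ {r : ℕ} (w : Fin (r + 1) → Val) :
    encFun w = .pair (w 0) (encFun fun i => w i.succ) := by
  simp [encFun, List.ofFn_succ]

theorem encVec_succ {r : ℕ} (g : Fin (r + 1) → ℤ) :
    encVec g = .pair (int (g 0)) (encVec fun i => g i.succ) :=
  encFun_succ _

section

variable {Γ : Type} {e : Γ → Val}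

/-- A power of two that exceeds a given number. -/
theorem polyTime_two_pow_size {u : Γ → ℕ} (hu : PolyTime e fun γ => encNat (u γ)) :
    PolyTime e fun γ => encNat (2 ^ (u γ).size) := by
  refine hu.halving (a := fun _ i => encNat (2 ^ i)) (.const e 1) ?_ ?_
  · refine ((hu.sizeBdd.add (.const _ 1)).comap Sigma.fst).mono fun x => ?_
    have := x.2.2
    simp only [encNat, size_int, Int.natAbs_natCast, Nat.size_pow]
    omega
  · have h := (PolyTime.refl fun x : Σ γ, Fin (u γ).size =>
      Val.pair (e x.1) (.pair (encNat (u x.1 / 2 ^ (x.2 : ℕ))) (encNat (2 ^ (x.2 : ℕ)))))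
    refine ((PolyTime.const _ 2).mul h.right.right).congr fun x => ?_
    simp only [encNat, pow_succ, int.injEq]
    push_cast
    ring

/-- Passage to a list of components. -/
theorem polyTime_map {r : Γ → ℕ} {w : ∀ γ, Fin (r γ) → Val} {g : Val → Val}
    (hw : PolyTime e fun γ => encFun (w γ)) (hg : PolyTime id g) :
    PolyTime e fun γ => encFun fun i => g (w γ i) := by
  refine hw.tab (g := fun γ i => g (w γ i)) ?_
  have h := (hw.lift (Sigma.fst : (Σ γ, Fin (r γ)) → Γ) fun x => encNat x.2).get
    (i := fun x => x.2) (PolyTime.refl _).right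
  exact h.trans (hg.comap fun x : Σ γ, Fin (r γ) => w x.1 x.2)

end

/-! ### Access to the fields of an encoded query. -/

namespace Query

theorem polyTime_edges : PolyTime encQuery fun Q => encFun fun e : Fin Q.inst.m =>
    .pair (encNat (Q.inst.tail e)) (.pair (encNat (Q.inst.head e)) (encNat (Q.inst.cap e))) :=
  (PolyTime.refl encQuery).left.right.left

theorem polyTime_pairs : PolyTime encQuery fun Q => encFun fun i : Fin Q.inst.k =>
    .pair (encNat (Q.inst.source i)) (.pair (encNat (Q.inst.target i))
      (.pair (encNat (Q.inst.demand i)) (encRat (Q.inst.weight i)))) :=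
  (PolyTime.refl encQuery).left.right.right

theorem polyTime_tail : PolyTime encQuery fun Q => encFun fun e => encNat (Q.inst.tail e) :=
  polyTime_map polyTime_edges (PolyTime.refl id).fst

theorem polyTime_head : PolyTime encQuery fun Q => encFun fun e => encNat (Q.inst.head e) :=
  polyTime_map polyTime_edges (PolyTime.refl id).snd.fst

theorem polyTime_cap : PolyTime encQuery fun Q => encVec fun e => (Q.inst.cap e : ℤ) :=
  polyTime_map polyTime_edges (PolyTime.refl id).snd.snd

theorem polyTime_len : PolyTime encQuery fun Q => encFun fun e => encRat (Q.len e) :=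
  (PolyTime.refl encQuery).right.left

theorem polyTime_z : PolyTime encQuery fun Q => encFun fun i => encRat (Q.z i) :=
  (PolyTime.refl encQuery).right.right

theorem polyTime_lenNum : PolyTime encQuery fun Q => encVec fun e => (Q.len e).num :=
  polyTime_map polyTime_len (PolyTime.refl id).fst

theorem polyTime_lenDen : PolyTime encQuery fun Q => encVec fun e => ((Q.len e).den : ℤ) :=
  polyTime_map polyTime_len (PolyTime.refl id).snd

theorem polyTime_zNum : PolyTime encQuery fun Q => encVec fun i => (Q.z i).num :=
  polyTime_map polyTime_z (PolyTime.refl id).fst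

theorem polyTime_zDen : PolyTime encQuery fun Q => encVec fun i => ((Q.z i).den : ℤ) :=
  polyTime_map polyTime_z (PolyTime.refl id).snd

theorem polyTime_source : PolyTime encQuery fun Q => encFun fun i => encNat (Q.inst.source i) :=
  polyTime_map polyTime_pairs (PolyTime.refl id).fst

theorem polyTime_target : PolyTime encQuery fun Q => encFun fun i => encNat (Q.inst.target i) :=
  polyTime_map polyTime_pairs (PolyTime.refl id).snd.fst

theorem polyTime_demand : PolyTime encQuery fun Q => encVec fun i => (Q.inst.demand i : ℤ) :=
  polyTime_map polyTime_pairs (PolyTime.refl id).snd.snd.fst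

theorem polyTime_weightNum : PolyTime encQuery fun Q => encVec fun i => (Q.inst.weight i).num :=
  polyTime_map polyTime_pairs (PolyTime.refl id).snd.snd.snd.fst

theorem polyTime_weightDen :
    PolyTime encQuery fun Q => encVec fun i => ((Q.inst.weight i).den : ℤ) :=
  polyTime_map polyTime_pairs (PolyTime.refl id).snd.snd.snd.snd

/-- The index of an edge that has been added to the context. -/
theorem polyTime_edgeIndex :
    PolyTime (fun x : Σ Q : Query, Fin Q.inst.m => .pair (encQuery x.1) (encNat x.2))
      fun x => encNat x.2 := (PolyTime.refl _).right

theorem polyTime_commonDen : PolyTime encQuery fun Q => int Q.commonDen :=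
  polyTime_len.prod ((polyTime_lenDen.lift Sigma.fst _).get_int polyTime_edgeIndex)

theorem polyTime_scaledLen : PolyTime encQuery fun Q => encVec Q.scaledLen :=
  polyTime_len.tab_int (((polyTime_lenNum.lift Sigma.fst _).get_int polyTime_edgeIndex).mul
    ((polyTime_commonDen.lift Sigma.fst _).div
      ((polyTime_lenDen.lift Sigma.fst _).get_int polyTime_edgeIndex)))

theorem polyTime_penalty : PolyTime encQuery fun Q => int Q.penalty :=
  (PolyTime.const _ 1).add (polyTime_len.sum
    (((polyTime_cap.lift Sigma.fst _).get_int polyTime_edgeIndex).mul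
      ((polyTime_scaledLen.lift Sigma.fst _).get_int polyTime_edgeIndex)))

/-! ### Computations for a single pair, and the full answer. -/

/-- A query with one of its pairs. -/
abbrev WithPair : Type := Σ Q : Query, Fin Q.inst.k

def encWithPair (x : WithPair) : Val := .pair (encQuery x.1) (encNat x.2)

theorem polyTime_pairIndex : PolyTime encWithPair fun x => encNat x.2 := (PolyTime.refl _).right

theorem polyTime_withPair {f : Query → Val} (h : PolyTime encQuery f) :
    PolyTime encWithPair fun x => f x.1 := h.lift Sigma.fst _

/-- The return edge has index 0, so each edge list of the network is the one of the query with an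
entry put in front. -/
theorem given_returnNetwork : Given encWithPair fun x => x.1.returnNetwork x.2 where
  verts := polyTime_withPair (PolyTime.refl encQuery).left.left
  tail := (((polyTime_withPair polyTime_target).get_fin polyTime_pairIndex).pair
    (polyTime_withPair polyTime_tail)).congr fun x => (encFun_succ (r := x.1.inst.m)
      fun i => encNat ((x.1.returnNetwork x.2).tail i)).symm
  head := (((polyTime_withPair polyTime_source).get_fin polyTime_pairIndex).pair
    (polyTime_withPair polyTime_head)).congr fun x => (encFun_succ (r := x.1.inst.m)
      fun i => encNat ((x.1.returnNetwork x.2).head i)).symm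
  cost := ((polyTime_withPair polyTime_penalty).neg.pair
    (polyTime_withPair polyTime_scaledLen)).congr fun x =>
      (encVec_succ (r := x.1.inst.m) (x.1.returnNetwork x.2).cost).symm

theorem polyTime_demandOf : PolyTime encWithPair fun x => int (x.1.inst.demand x.2 : ℤ) :=
  (polyTime_withPair polyTime_demand).get_int polyTime_pairIndex

theorem polyTime_capBound : PolyTime encWithPair fun x => encNat (x.1.capBound x.2) := by
  refine (polyTime_demandOf.add (polyTime_withPair (polyTime_len.sum
    (h := fun Q e => (Q.inst.cap e : ℤ))
      ((polyTime_cap.lift Sigma.fst _).get_int polyTime_edgeIndex)))).congr fun x => ?_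
  simp only [encNat, capBound]
  push_cast
  rfl

theorem polyTime_circulation : PolyTime encWithPair fun x => encState (x.1.circulation x.2) :=
  given_returnNetwork.scaling (c := fun x => x.1.returnCap x.2)
    ((polyTime_demandOf.pair (polyTime_withPair polyTime_cap)).congr
      fun x => (encVec_succ (r := x.1.inst.m) (x.1.returnCap x.2)).symm)
    (polyTime_two_pow_size polyTime_capBound)

theorem polyTime_flow : PolyTime encWithPair fun x =>
    .pair (int (x.1.returnFlow x.2)) (encVec (x.1.edgeFlow x.2)) :=
  polyTime_circulation.right.left.congr fun x =>
    encVec_succ (r := x.1.inst.m) (x.1.circulation x.2).flow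

theorem polyTime_isDemand : PolyTime encWithPair fun x =>
    ofBool (decide (x.1.returnFlow x.2 = x.1.inst.demand x.2)) :=
  polyTime_flow.left.eq polyTime_demandOf

theorem polyTime_flowOf : PolyTime encWithPair fun x =>
    encOption (fun f => encFun fun e => encNat (f e)) (x.1.flowOf x.2) := by
  refine (polyTime_isDemand.ite ((PolyTime.const _ 1).pair polyTime_flow.right)
    (PolyTime.const _ 0)).congr fun x => ?_
  simp only [flowOf, decide_eq_true_eq]
  split_ifs
  · simp only [encOption, encNat, toNat_edgeFlow, encVec]
  · rfl

theorem polyTime_violated : PolyTime encWithPair fun x => ofBool (x.1.violated x.2) := by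
  have hD := polyTime_withPair polyTime_commonDen
  have hzn := (polyTime_withPair polyTime_zNum).get_int polyTime_pairIndex
  have hzd := (polyTime_withPair polyTime_zDen).get_int polyTime_pairIndex
  have hwn := (polyTime_withPair polyTime_weightNum).get_int polyTime_pairIndex
  have hwd := (polyTime_withPair polyTime_weightDen).get_int polyTime_pairIndex
  have hj := (PolyTime.refl fun y : Σ x : WithPair, Fin x.1.inst.m =>
    Val.pair (encWithPair y.1) (encNat y.2)).right
  have hC : PolyTime encWithPair fun x => int (∑ e, x.1.edgeFlow x.2 e * x.1.scaledLen e) :=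
    (polyTime_withPair polyTime_scaledLen).sum
      (((polyTime_flow.right.lift Sigma.fst _).get_int hj).mul
        (((polyTime_withPair polyTime_scaledLen).lift Sigma.fst _).get_int hj))
  exact polyTime_isDemand.and ((((hzn.mul hwd).mul hD).add ((hC.mul hzd).mul hwd)).lt
    ((hwn.mul hzd).mul hD))

/-- The list of the `z i` is used only to enumerate the pairs. -/
theorem polyTime_checked : PolyTime encQuery fun Q => encAnswer Q
    (.checked Q.flowOf ((List.finRange Q.inst.k).find? Q.violated)) :=
  (PolyTime.const _ 2).pair (.pair (polyTime_z.tab polyTime_flowOf)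
    (polyTime_z.find polyTime_violated))

theorem polyTime_answer : PolyTime encQuery fun Q => encAnswer Q Q.answer := by
  have hneg : PolyTime (fun x : Σ Q : Query, Fin Q.inst.m => .pair (encQuery x.1) (encNat x.2))
      fun x => ofBool (decide ((x.1.len x.2).num < 0)) :=
    ((polyTime_lenNum.lift Sigma.fst _).get_int polyTime_edgeIndex).lt (.const _ 0)
  have hnegz : PolyTime encWithPair fun x => ofBool (decide ((x.1.z x.2).num < 0)) :=
    ((polyTime_withPair polyTime_zNum).get_int polyTime_pairIndex).lt (.const _ 0)
  refine (polyTime_len.find (p := fun (Q : Query) e => decide ((Q.len e).num < 0))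
    hneg).option_cases ?_ ?_
  · have hz : PolyTime encQuery fun Q => encOption (fun i : Fin Q.inst.k => encNat i)
        ((List.finRange Q.inst.k).find? fun i => decide ((Q.z i).num < 0)) :=
      polyTime_z.find (p := fun (Q : Query) i => decide ((Q.z i).num < 0)) hnegz
    -- The subtypes record the outcomes of the sign searches, which determine the branch of
    -- `answer`.
    refine (hz.comap Subtype.val).option_cases ?_ ?_
    · refine ((polyTime_checked.comap Subtype.val).comap Subtype.val).congr fun x => ?_
      simp only [answer, x.1.2, x.2]
    · refine ((PolyTime.const _ 1).pair (PolyTime.refl _).right).congr fun x => ?_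
      simp only [answer, x.1.1.2, x.2]
      rfl
  · refine ((PolyTime.const _ 0).pair (PolyTime.refl _).right).congr fun x => ?_
    simp only [answer, x.2]
    rfl

end Query

end ANF

theorem mainTheorem8 :
    While.SolvableInPolyTime ANF.encQuery ANF.encAnswer ANF.Answer.Correct ∧
    ∀ (I : ANF.Instance) (ℓ : Fin I.m → ℝ) (z : Fin I.k → ℝ),
      (∀ e, 0 ≤ ℓ e) → (∀ i, 0 ≤ z i) →
      (I.DualFeasible ℓ z ↔
        ∀ i, ((I.weight i : ℝ) : EReal) ≤ (z i : EReal) + I.minCost ℓ i) :=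
  ⟨While.PolyTime.solvable ANF.Query.answer ANF.Query.polyTime_answer ANF.Query.answer_correct,
    ANF.Instance.dualFeasible_iff_minCost⟩
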